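/- **Setting.** A probe of $n$ qubits obeys the Lindblad master equation $$\frac{d\rho}{dt}=-i[H,\rho]+\sum_a\Big(L_a\rho L_a^\dagger-\tfrac12\{L_a^\dagger L_a,\rho\}\Big),\qquad H=\omega G+H_0,\quad G=\sum_{1\le i<j<k\le n}Z_iZ_jZ_k,$$ where $\omega\in\mathbb R$ is to be estimated, $H_0$ is any $2$-local Hamiltonian and $\{L_a\}$ is any finite family of operators each acting non-trivially on at most one qubit. Let $\mathcal L_\omega$ be the generator of this equation. Let $\mathscr S$ be the stabilizer group (an abelian subgroup of the $n$-qubit Pauli group with $-I\notin\mathscr S$) of an $[[n,1,3]]$ stabilizer code. A Pauli operator is called logical if it lies in the normalizer of $\mathscr S$ and no scalar multiple of it lies in $\mathscr S$; thus the code space has dimension $2$, and the least weight of a logical operator is $3$. Let $\ell$ be the number of terms $Z_iZ_jZ_k$ $(i<j<k)$ of $G$ that are logical operators. A recovery is a quantum channel $R$ whose outputs are supported on the code space and which, for each operator $B$ acting non-trivially on at most one qubit, satisfies $R(BAB^\dagger)=c_B A$ for all operators $A$ supported on the code space, with a scalar $c_B$ depending only on $B$. The output state in the fast-control limit, for the initial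 state $\rho(0)$, is $$\rho_\omega(t)=\lim_{m\to\infty}\big(R\circ e^{(t/m)\mathcal L_\omega}\big)^m\rho(0).$$ Its quantum Fisher information (QFI) about $\omega$ is $F(\rho_\omega(t))=\operatorname{tr}(\rho_\omega(t)L^2)$, where $L$ is Hermitian with $\partial_\omega\rho_\omega(t)=\frac12\big(L\rho_\omega(t)+\rho_\omega(t)L\big)$. **Lemma.** For every $[[n,1,3]]$ stabilizer code a recovery exists. For every recovery $R$, all $H_0$ and $\{L_a\}$ as above, every density operator $\rho(0)$ supported on the code space, every $t\ge0$ and every $\omega$, the output state and its QFI are well defined and $$F(\rho_\omega(t))\le 4\ell^2t^2 .$$ If moreover every $Z$-type stabilizer (a stabilizer consisting only of $I$ and $Z$) has a positive sign, then equality is attained: there is a pure state in the code space, depending only on the code, for which $F(\rho_\omega(t))=4\ell^2t^2$ for all such $R$, $H_0$, $\{L_a\}$, $t$ and $\omega$. -/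

import Mathlib

open scoped ComplexOrder Matrix

noncomputable section

namespace QuantumMetrology

/-! ### Operators on `n` qubits -/

/-- Computational basis labels of `n` qubits. -/
abbrev Basis (n : ℕ) := Fin n → Fin 2

/-- State vectors of `n` qubits, in the computational basis. -/
abbrev Ket (n : ℕ) := Basis n → ℂ

/-- Operators on `n` qubits, in the computational basis. -/
abbrev Op (n : ℕ) := Matrix (Basis n) (Basis n) ℂ

/-- The product operator `A 0 ⊗ A 1 ⊗ ⋯ ⊗ A (n-1)`. -/
def tensor {n : ℕ} (A : Fin n → Matrix (Fin 2) (Fin 2) ℂ) : Op n :=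
  Matrix.of fun x y => ∏ q, A q (x q) (y q)

/-- The operator acting as `B` on qubit `i` and as the identity on all the other qubits. -/
def onQubit {n : ℕ} (i : Fin n) (B : Matrix (Fin 2) (Fin 2) ℂ) : Op n :=
  tensor (Function.update (fun _ => 1) i B)

/-- `A` acts non-trivially on at most one qubit. -/
def IsSingleQubit {n : ℕ} (A : Op n) : Prop :=
  ∃ (i : Fin n) (B : Matrix (Fin 2) (Fin 2) ℂ), A = onQubit i B

open Classical in
/-- `A` is `k`-local: a linear combination of operators each acting non-trivially
on at most `k` qubits. -/
def IsLocal {n : ℕ} (k : ℕ) (A : Op n) : Prop :=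
  A ∈ Submodule.span ℂ
    {T : Op n | ∃ B : Fin n → Matrix (Fin 2) (Fin 2) ℂ,
      (Finset.univ.filter fun q => B q ≠ 1).card ≤ k ∧ T = tensor B}

/-! ### Pauli operators -/

/-- The labels of the single-qubit Pauli operators. -/
inductive Pauli
  | I | X | Y | Z

/-- The single-qubit Pauli matrices. -/
def Pauli.mat : Pauli → Matrix (Fin 2) (Fin 2) ℂ
  | .I => 1
  | .X => !![0, 1; 1, 0]
  | .Y => !![0, -Complex.I; Complex.I, 0]
  | .Z => !![1, 0; 0, -1]

/-- The `n`-qubit Pauli operator `P 0 ⊗ ⋯ ⊗ P (n-1)` (with coefficient `+1`). -/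
def pauliOp {n : ℕ} (P : Fin n → Pauli) : Op n := tensor fun q => (P q).mat

open Classical in
/-- The weight of a Pauli string: the number of qubits on which it is not the identity. -/
def weight {n : ℕ} (P : Fin n → Pauli) : ℕ := (Finset.univ.filter fun q => P q ≠ Pauli.I).card

/-- Membership in the `n`-qubit Pauli group `{±1, ±i} × {I, X, Y, Z}^{⊗ n}`. -/
def InPauliGroup {n : ℕ} (A : Op n) : Prop :=
  ∃ (c : ℂ) (P : Fin n → Pauli),
    (c = 1 ∨ c = -1 ∨ c = Complex.I ∨ c = -Complex.I) ∧ A = c • pauliOp P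

/-! ### Stabilizer codes -/

/-- A stabilizer group: an abelian subgroup of the `n`-qubit Pauli group not containing `-1`. -/
structure StabilizerCode (n : ℕ) where
  group : Subgroup (Op n)ˣ
  pauli : ∀ s ∈ group, InPauliGroup (s : Op n)
  comm : ∀ s ∈ group, ∀ s' ∈ group, s * s' = s' * s
  neg_one : (-1 : (Op n)ˣ) ∉ group

namespace StabilizerCode

variable {n : ℕ} (C : StabilizerCode n)

/-- The operator `A` is a stabilizer of the code. -/
def IsStabilizer (A : Op n) : Prop := ∃ s ∈ C.group, (s : Op n) = A

/-- The code space: the joint `+1` eigenspace of all the stabilizers. -/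
def codeSpace : Submodule ℂ (Ket n) where
  carrier := {v | ∀ s ∈ C.group, (s : Op n) *ᵥ v = v}
  add_mem' := by
    intro a b ha hb s hs
    rw [Matrix.mulVec_add, ha s hs, hb s hs]
  zero_mem' := by
    intro s _
    exact Matrix.mulVec_zero _
  smul_mem' := by
    intro c v hv s hs
    rw [Matrix.mulVec_smul, hv s hs]

/-- The Pauli string `P` is a (non-trivial) logical operator: it normalizes the stabilizer group,
but it is not a stabilizer up to a phase, hence does not act as a scalar on the code space. -/
def IsLogical (P : Fin n → Pauli) : Prop :=
  (∃ u : (Op n)ˣ, (u : Op n) = pauliOp P ∧ u ∈ Subgroup.normalizer (C.group : Set (Op n)ˣ)) ∧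
    ∀ c : ℂ, ¬ C.IsStabilizer (c • pauliOp P)

/-- `C` is an `[[n, k, d]]` code: the code space has dimension `2 ^ k`, and `d` is the minimal
weight of a logical operator. -/
def HasParameters (k d : ℕ) : Prop :=
  Module.finrank ℂ C.codeSpace = 2 ^ k ∧ IsLeast {w | ∃ P, C.IsLogical P ∧ weight P = w} d

/-- Every `Z`-type stabilizer (consisting of `I` and `Z` only) has a positive sign. -/
def PositiveZType : Prop :=
  ∀ (c : ℂ) (P : Fin n → Pauli), (∀ q, P q = Pauli.I ∨ P q = Pauli.Z) →
    C.IsStabilizer (c • pauliOp P) → c = 1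

/-- `A` is an operator on the code space, i.e. `Π A Π = A` with `Π` the projection onto it. -/
def SupportsOp (A : Op n) : Prop :=
  (∀ v, A *ᵥ v ∈ C.codeSpace) ∧ ∀ v, Aᴴ *ᵥ v ∈ C.codeSpace

/-- `ρ` is a density operator supported on the code space. -/
def IsCodeState (ρ : Op n) : Prop :=
  ρ.PosSemidef ∧ ρ.trace = 1 ∧ C.SupportsOp ρ

end StabilizerCode

/-! ### The Hamiltonian term `G` -/

/-- The triples of qubits `i < j < k`. -/
def triples (n : ℕ) : Finset (Fin n × Fin n × Fin n) :=
  Finset.univ.filter fun p => p.1 < p.2.1 ∧ p.2.1 < p.2.2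

/-- The Pauli string `Z_i Z_j Z_k`, where `p = (i, j, k)`. -/
def zzz {n : ℕ} (p : Fin n × Fin n × Fin n) : Fin n → Pauli :=
  fun q => if q = p.1 ∨ q = p.2.1 ∨ q = p.2.2 then Pauli.Z else Pauli.I

/-- `G = ∑_{i < j < k} Z_i Z_j Z_k`. -/
def G (n : ℕ) : Op n := ∑ p ∈ triples n, pauliOp (zzz p)

open Classical in
/-- The number of terms `Z_i Z_j Z_k` of `G` that are logical operators of the code. -/
def numLogical {n : ℕ} (C : StabilizerCode n) : ℕ :=
  ((triples n).filter fun p => C.IsLogical (zzz p)).card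

/-! ### Markovian dynamics and error correction -/

/-- A background 2-local Hamiltonian `H₀` and finitely many single-qubit Lindblad operators. -/
structure Environment (n : ℕ) where
  H₀ : Op n
  hermitian : H₀.IsHermitian
  twoLocal : IsLocal 2 H₀
  numNoise : ℕ
  noise : Fin numNoise → Op n
  singleQubit : ∀ a, IsSingleQubit (noise a)

/-- The right-hand side `-i[H, ρ] + ∑ₐ (Lₐ ρ Lₐ† - ½ {Lₐ† Lₐ, ρ})` of the master equation, with
`H = ω G + H₀`. -/
def lindbladian {n : ℕ} (E : Environment n) (ω : ℝ) (ρ : Op n) : Op n :=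
  let H : Op n := (ω : ℂ) • G n + E.H₀
  (-Complex.I) • (H * ρ - ρ * H) +
    ∑ a, (E.noise a * ρ * (E.noise a)ᴴ -
      (1 / 2 : ℂ) • ((E.noise a)ᴴ * E.noise a * ρ + ρ * ((E.noise a)ᴴ * E.noise a)))

/-- The solution `exp(s 𝓛) ρ = ∑ₖ (s ^ k / k!) 𝓛 ^ k ρ` at time `s` of the master equation with
initial value `ρ`. -/
def evolve {n : ℕ} (E : Environment n) (ω s : ℝ) (ρ : Op n) : Op n :=
  ∑' k : ℕ, ((s ^ k / k.factorial : ℝ) : ℂ) • (lindbladian E ω)^[k] ρ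

/-- `R` is a quantum channel (completely positive and trace preserving), in Kraus form. -/
def IsChannel {n : ℕ} (R : Op n → Op n) : Prop :=
  ∃ (r : ℕ) (K : Fin r → Op n),
    ∑ a, (K a)ᴴ * K a = 1 ∧ ∀ A, R A = ∑ a, K a * A * (K a)ᴴ

/-- `R` is a recovery channel of the code for single-qubit errors: a channel that returns to the
code space and undoes every single-qubit error (including the identity) on code states, up to
normalization. -/
def IsRecovery {n : ℕ} (C : StabilizerCode n) (R : Op n → Op n) : Prop :=
  IsChannel R ∧ (∀ A, C.SupportsOp (R A)) ∧
    ∀ B, IsSingleQubit B → ∃ c : ℂ, ∀ A, C.SupportsOp A → R (B * A * Bᴴ) = c • A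

/-- The state at time `t` when the recovery `R` is applied at the `m` times
`t/m, 2t/m, …, t` during the noisy evolution. -/
def controlledState {n : ℕ} (E : Environment n) (R : Op n → Op n) (ω t : ℝ) (ρ₀ : Op n) (m : ℕ) :
    Op n :=
  (fun ρ => R (evolve E ω (t / m) ρ))^[m] ρ₀

/-- `ρ` is the output state in the fast-control limit, where the time between two recoveries
tends to zero. -/
def IsOutputState {n : ℕ} (E : Environment n) (R : Op n → Op n) (ω t : ℝ) (ρ₀ ρ : Op n) : Prop :=
  Filter.Tendsto (controlledState E R ω t ρ₀) Filter.atTop (nhds ρ)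

/-! ### Quantum Fisher information -/

/-- `F` is the quantum Fisher information at `ω` of the family of states `ρ`: `F = tr (ρ L²)`,
where `L` is a symmetric logarithmic derivative, i.e. `L` is Hermitian and
`∂ρ/∂ω = ½ (L ρ + ρ L)`. -/
def IsQFI {n : ℕ} (ρ : ℝ → Op n) (ω F : ℝ) : Prop :=
  ∃ L : Op n, L.IsHermitian ∧
    (∀ x y, HasDerivAt (fun w => ρ w x y) (((1 / 2 : ℂ) • (L * ρ ω + ρ ω * L)) x y) ω) ∧
    (F : ℂ) = (ρ ω * (L * L)).trace

/-- `F` is the quantum Fisher information `F(ρ_ω(t))` about `ω` of the output states at time `t`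
in the fast-control limit, starting from the initial state `ρ₀`. -/
def IsOutputQFI {n : ℕ} (E : Environment n) (R : Op n → Op n) (t : ℝ) (ρ₀ : Op n) (ω F : ℝ) :
    Prop :=
  ∃ ρ : ℝ → Op n, (∀ w, IsOutputState E R w t ρ₀ (ρ w)) ∧ IsQFI ρ ω F

end QuantumMetrology

end

/-! Let `Π` be the average of the stabilizers, the projector onto the code space. A Pauli operator
that is not logical either anticommutes with a stabilizer or is proportional to one, so its
compression by `Π` is a multiple of `Π`. Since logical operators have weight at least 3, this holds
for every 2-local operator (`exists_projector_mul_mul_projector_of_isLocal`). A recovery exists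
because the code spaces displaced by single-qubit Pauli errors are pairwise equal or orthogonal
(`exists_isRecovery`).

Nothing is assumed about how an arbitrary recovery `R` acts off the correctable subspace, although
`G` leads there. What rescues the argument is that `R` fixes code operators, so its Kraus operators
act on the code space as scalars, and then `R (X * A) = Π * X * A` for every `X` and every code
operator `A` (`IsRecovery.apply_mul`). Hence `H₀` and the non-logical terms of `G` become scalars
and drop out of the commutator, while the dissipator cancels by trace preservation. On code
operators `R ∘ 𝓛` is therefore `-iω[Q, ·]`, with `Q` the sum of the logical terms of `G`
(`IsRecovery.apply_lindbladian`). A product formula of Lie-Trotter type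
(`tendsto_iterate_fastControl`) turns this into the limit state `exp(-iωtQ) ρ₀ exp(iωtQ)`.

For this unitary family any symmetric logarithmic derivative gives `F ≤ 4t² tr(ρQ²)`, and `Q` is
diagonal with entries bounded by `ℓ` (`le_four_mul_trace_of_sld`). One exists because
Cayley-Hamilton on the two-dimensional code space makes `2 ∂ρ` work (`sld_of_mul_self_eq`). If the
`Z`-type stabilizers are positive, `|0⋯0⟩` has a nonzero projection onto the code space, fixed by
all logical `Z_iZ_jZ_k`. These operators are traceless involutions there, so they all coincide, and
`Q` has eigenvalues `±ℓ`. The equal superposition of the two eigenvectors is optimal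
(`exists_optimal_state`). -/

noncomputable section

namespace QuantumMetrology

/-! ### Product operators -/

section Tensor

variable {n : ℕ}

theorem tensor_apply (A : Fin n → Matrix (Fin 2) (Fin 2) ℂ) (x y : Basis n) :
    tensor A x y = ∏ q, A q (x q) (y q) := rfl

theorem tensor_mul (A B : Fin n → Matrix (Fin 2) (Fin 2) ℂ) :
    tensor A * tensor B = tensor fun q => A q * B q := by
  ext x y
  simp only [Matrix.mul_apply, tensor_apply, Finset.prod_univ_sum, Fintype.piFinset_univ,
    Finset.prod_mul_distrib]

theorem tensor_one : tensor (fun _ : Fin n => (1 : Matrix (Fin 2) (Fin 2) ℂ)) = 1 := by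
  ext x y
  rw [tensor_apply, Matrix.one_apply]
  split_ifs with h
  · exact Finset.prod_eq_one fun q _ => by rw [h]; exact Matrix.one_apply_eq _
  · obtain ⟨q, hq⟩ := Function.ne_iff.1 h
    exact Finset.prod_eq_zero (Finset.mem_univ q) (Matrix.one_apply_ne hq)

theorem tensor_conjTranspose (A : Fin n → Matrix (Fin 2) (Fin 2) ℂ) :
    (tensor A)ᴴ = tensor fun q => (A q)ᴴ := by
  ext x y
  simp [Matrix.conjTranspose_apply, tensor_apply]

theorem trace_tensor (A : Fin n → Matrix (Fin 2) (Fin 2) ℂ) :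
    (tensor A).trace = ∏ q, (A q).trace := by
  simp only [Matrix.trace, Matrix.diag_apply, tensor_apply, Finset.prod_univ_sum,
    Fintype.piFinset_univ]

theorem tensor_smul (c : Fin n → ℂ) (A : Fin n → Matrix (Fin 2) (Fin 2) ℂ) :
    tensor (fun q => c q • A q) = (∏ q, c q) • tensor A := by
  ext x y
  simp [tensor_apply, Finset.prod_mul_distrib]

theorem tensor_sum {ι : Type*} [Fintype ι] [DecidableEq ι]
    (A : Fin n → ι → Matrix (Fin 2) (Fin 2) ℂ) :
    tensor (fun q => ∑ i, A q i) = ∑ f : Fin n → ι, tensor fun q => A q (f q) := by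
  ext x y
  simp only [tensor_apply, Matrix.sum_apply, Finset.prod_univ_sum, Fintype.piFinset_univ]

theorem onQubit_mul (i : Fin n) (A B : Matrix (Fin 2) (Fin 2) ℂ) :
    onQubit i A * onQubit i B = onQubit i (A * B) := by
  rw [onQubit, onQubit, onQubit, tensor_mul]
  congr 1
  ext q : 1
  by_cases h : q = i
  · subst h; simp
  · simp [h]

theorem onQubit_one (i : Fin n) : onQubit i (1 : Matrix (Fin 2) (Fin 2) ℂ) = 1 := by
  rw [onQubit, ← tensor_one]
  congr 1
  ext q : 1
  by_cases h : q = i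
  · subst h; simp
  · simp [h]

theorem onQubit_conjTranspose (i : Fin n) (A : Matrix (Fin 2) (Fin 2) ℂ) :
    (onQubit i A)ᴴ = onQubit i Aᴴ := by
  rw [onQubit, onQubit, tensor_conjTranspose]
  congr 1
  ext q : 1
  by_cases h : q = i
  · subst h; simp
  · simp [h]

theorem onQubit_apply (i : Fin n) (A : Matrix (Fin 2) (Fin 2) ℂ) (x y : Basis n) :
    onQubit i A x y =
      A (x i) (y i) * ∏ q ∈ Finset.univ.erase i, (1 : Matrix (Fin 2) (Fin 2) ℂ) (x q) (y q) := by
  rw [onQubit, tensor_apply, ← Finset.mul_prod_erase _ _ (Finset.mem_univ i)]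
  congr 1
  · simp
  · refine Finset.prod_congr rfl fun q hq => ?_
    rw [Function.update_of_ne (Finset.ne_of_mem_erase hq)]

theorem onQubit_add (i : Fin n) (A B : Matrix (Fin 2) (Fin 2) ℂ) :
    onQubit i (A + B) = onQubit i A + onQubit i B := by
  ext x y
  simp only [onQubit_apply, Matrix.add_apply, add_mul]

theorem onQubit_smul (i : Fin n) (c : ℂ) (A : Matrix (Fin 2) (Fin 2) ℂ) :
    onQubit i (c • A) = c • onQubit i A := by
  ext x y
  simp only [onQubit_apply, Matrix.smul_apply, smul_eq_mul, mul_assoc]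

theorem isLocal_two_onQubit_mul_onQubit (i j : Fin n) (A B : Matrix (Fin 2) (Fin 2) ℂ) :
    IsLocal 2 (onQubit i A * onQubit j B) := by
  classical
  refine Submodule.subset_span ⟨_, ?_, tensor_mul _ _⟩
  refine (Finset.card_le_card (t := {i, j}) fun q hq => ?_).trans Finset.card_le_two
  by_contra h
  simp only [Finset.mem_insert, Finset.mem_singleton, not_or] at h
  simp [h.1, h.2] at hq

theorem isLocal_two_onQubit (i : Fin n) (A : Matrix (Fin 2) (Fin 2) ℂ) :
    IsLocal 2 (onQubit i A) := by
  simpa [onQubit_one] using isLocal_two_onQubit_mul_onQubit i i A 1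

end Tensor

/-! ### Pauli operators -/

instance : DecidableEq Pauli := fun a b => by
  cases a <;> cases b <;> first | exact isTrue rfl | exact isFalse nofun

instance : Fintype Pauli := ⟨{.I, .X, .Y, .Z}, fun a => by cases a <;> simp⟩

theorem Pauli.sum_univ {M : Type*} [AddCommMonoid M] (f : Pauli → M) :
    ∑ p, f p = f .I + (f .X + (f .Y + f .Z)) := by
  change ∑ p ∈ ({.I, .X, .Y, .Z} : Finset Pauli), f p = _
  rw [Finset.sum_insert (by simp), Finset.sum_insert (by simp), Finset.sum_insert (by simp),
    Finset.sum_singleton]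

theorem Pauli.mat_conjTranspose (p : Pauli) : p.matᴴ = p.mat := by
  cases p <;> ext i j <;> fin_cases i <;> fin_cases j <;>
    simp [Pauli.mat, Matrix.conjTranspose_apply]

theorem Pauli.mat_mul_self (p : Pauli) : p.mat * p.mat = 1 := by
  cases p <;> ext i j <;> fin_cases i <;> fin_cases j <;>
    simp [Pauli.mat, Matrix.mul_apply]

theorem Pauli.mat_mul_comm (p p' : Pauli) :
    ∃ ε : ℂ, (ε = 1 ∨ ε = -1) ∧ p.mat * p'.mat = ε • (p'.mat * p.mat) := by
  have key : p.mat * p'.mat = (1 : ℂ) • (p'.mat * p.mat) ∨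
      p.mat * p'.mat = (-1 : ℂ) • (p'.mat * p.mat) := by
    cases p <;> cases p' <;>
      first
      | (left; simp [Pauli.mat]; done)
      | (right; ext i j; fin_cases i <;> fin_cases j <;> simp [Pauli.mat, Matrix.mul_apply])
  rcases key with h | h
  exacts [⟨1, Or.inl rfl, h⟩, ⟨-1, Or.inr rfl, h⟩]

theorem Pauli.trace_mat_mul_mat_of_ne {p p' : Pauli} (h : p ≠ p') :
    (p.mat * p'.mat).trace = 0 := by
  cases p <;> cases p' <;> first | exact absurd rfl h |
    simp [Pauli.mat, Matrix.trace]

/-- The coefficients of a matrix in the Pauli basis. -/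
def pauliCoeff (M : Matrix (Fin 2) (Fin 2) ℂ) (p : Pauli) : ℂ := (1 / 2) * (p.mat * M).trace

theorem sum_pauliCoeff_smul (M : Matrix (Fin 2) (Fin 2) ℂ) :
    ∑ p, pauliCoeff M p • p.mat = M := by
  rw [Pauli.sum_univ, Matrix.eta_fin_two M]
  ext i j
  fin_cases i <;> fin_cases j <;>
    simp [pauliCoeff, Pauli.mat, Matrix.trace, Fin.sum_univ_two] <;>
    ring_nf <;> simp <;> ring

theorem pauliCoeff_one_of_ne {p : Pauli} (h : p ≠ .I) : pauliCoeff 1 p = 0 := by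
  have := Pauli.trace_mat_mul_mat_of_ne h
  rw [pauliCoeff]
  simp only [Pauli.mat] at this ⊢
  rw [this, mul_zero]

section PauliOp

variable {n : ℕ}

theorem pauliOp_isHermitian (P : Fin n → Pauli) : (pauliOp P)ᴴ = pauliOp P := by
  rw [pauliOp, tensor_conjTranspose]
  simp only [Pauli.mat_conjTranspose]

theorem pauliOp_mul_self (P : Fin n → Pauli) : pauliOp P * pauliOp P = 1 := by
  rw [pauliOp, tensor_mul, ← tensor_one]
  simp only [Pauli.mat_mul_self]

theorem pauliOp_mul_comm (P P' : Fin n → Pauli) :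
    Commute (pauliOp P) (pauliOp P') ∨
      pauliOp P * pauliOp P' = -(pauliOp P' * pauliOp P) := by
  choose ε hε h using fun q => Pauli.mat_mul_comm (P q) (P' q)
  have hprod : ∏ q, ε q = 1 ∨ ∏ q, ε q = -1 := by
    refine Finset.prod_induction ε (fun c => c = 1 ∨ c = -1) ?_ (Or.inl rfl) fun q _ => hε q
    rintro a b (rfl | rfl) (rfl | rfl) <;> simp
  have key : pauliOp P * pauliOp P' = (∏ q, ε q) • (pauliOp P' * pauliOp P) := by
    simp only [pauliOp, tensor_mul, ← tensor_smul, h]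
  rcases hprod with h1 | h1 <;> rw [h1] at key
  · exact Or.inl (by rw [Commute, SemiconjBy, key, one_smul])
  · exact Or.inr (by rw [key, neg_smul, one_smul])

theorem trace_pauliOp_mul_of_ne {P P' : Fin n → Pauli} (h : P ≠ P') :
    (pauliOp P * pauliOp P').trace = 0 := by
  obtain ⟨q, hq⟩ := Function.ne_iff.1 h
  rw [pauliOp, pauliOp, tensor_mul, trace_tensor]
  exact Finset.prod_eq_zero (Finset.mem_univ q) (Pauli.trace_mat_mul_mat_of_ne hq)

theorem onQubit_pauli (i : Fin n) (p : Pauli) :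
    onQubit i p.mat = pauliOp (Function.update (fun _ => Pauli.I) i p) := by
  rw [onQubit, pauliOp]
  congr 1
  ext q : 1
  by_cases h : q = i
  · subst h; simp
  · simp [h, Pauli.mat]

/-- A `k`-local operator is a linear combination of Pauli operators of weight at most `k`. -/
theorem IsLocal.induction_pauli {k : ℕ} {A : Op n} (hA : IsLocal k A) (p : Submodule ℂ (Op n))
    (hp : ∀ P : Fin n → Pauli, weight P ≤ k → pauliOp P ∈ p) : A ∈ p := by
  classical
  refine Submodule.span_le.2 ?_ hA
  rintro _ ⟨B, hB, rfl⟩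
  have hexp : tensor B = ∑ P : Fin n → Pauli, (∏ q, pauliCoeff (B q) (P q)) • pauliOp P := by
    conv_lhs => rw [show B = fun q => ∑ p, pauliCoeff (B q) p • p.mat from
      funext fun q => (sum_pauliCoeff_smul _).symm]
    rw [tensor_sum]
    simp only [tensor_smul, pauliOp]
  rw [SetLike.mem_coe, hexp]
  refine p.sum_mem fun P _ => ?_
  by_cases hw : weight P ≤ k
  · exact p.smul_mem _ (hp P hw)
  -- A string heavier than the number of nontrivial factors has a non-identity letter at some factor
  -- `1`, where its Pauli coefficient is zero.
  · obtain ⟨q, hq, hq'⟩ : ∃ q, P q ≠ Pauli.I ∧ B q = 1 := by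
      by_contra! hcon
      refine hw (le_trans (Finset.card_le_card fun q hq => ?_) hB)
      simp only [Finset.mem_filter, Finset.mem_univ, true_and] at hq ⊢
      exact hcon q hq
    rw [Finset.prod_eq_zero (Finset.mem_univ q), zero_smul]
    · exact p.zero_mem
    · rw [hq', pauliCoeff_one_of_ne hq]

end PauliOp

/-! ### The projector onto the code space -/

namespace StabilizerCode

variable {n : ℕ} (C : StabilizerCode n)

/-- The phases `±i` are excluded because such an element would square to `-1`. Real phases make
every stabilizer Hermitian. -/
theorem exists_eq_smul_pauliOp {s : (Op n)ˣ} (hs : s ∈ C.group) :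
    ∃ (c : ℂ) (P : Fin n → Pauli), (c = 1 ∨ c = -1) ∧ (s : Op n) = c • pauliOp P := by
  obtain ⟨c, P, hc, h⟩ := C.pauli s hs
  have hsq : c * c ≠ -1 := fun hc' => C.neg_one <| by
    convert C.group.mul_mem hs hs
    ext1
    rw [Units.val_neg, Units.val_one, Units.val_mul, h, smul_mul_smul_comm, pauliOp_mul_self, hc',
      neg_smul, one_smul]
  rcases hc with hc | hc | hc | hc
  · exact ⟨c, P, Or.inl hc, h⟩
  · exact ⟨c, P, Or.inr hc, h⟩
  · exact absurd (by rw [hc, Complex.I_mul_I]) hsq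
  · exact absurd (by rw [hc, neg_mul_neg, Complex.I_mul_I]) hsq

theorem stabilizer_conjTranspose {s : (Op n)ˣ} (hs : s ∈ C.group) : (s : Op n)ᴴ = s := by
  obtain ⟨c, P, hc, h⟩ := C.exists_eq_smul_pauliOp hs
  rw [h, Matrix.conjTranspose_smul, pauliOp_isHermitian]
  rcases hc with rfl | rfl <;> simp

instance : Finite C.group := by
  have hfin : (Set.range fun x : Bool × (Fin n → Pauli) =>
      (if x.1 then (1 : ℂ) else -1) • pauliOp x.2).Finite := Set.finite_range _
  have hmem : ∀ s : C.group, ((s : (Op n)ˣ) : Op n) ∈ Set.range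
      fun x : Bool × (Fin n → Pauli) => (if x.1 then (1 : ℂ) else -1) • pauliOp x.2 := by
    intro s
    obtain ⟨c, P, hc, h⟩ := C.exists_eq_smul_pauliOp s.2
    rcases hc with rfl | rfl
    exacts [⟨(true, P), by simp [h]⟩, ⟨(false, P), by simp [h]⟩]
  have := hfin.to_subtype
  exact Finite.of_injective (fun s => Subtype.mk _ (hmem s)) fun s s' h =>
    Subtype.ext (Units.ext (congrArg Subtype.val h))

instance : Fintype C.group := Fintype.ofFinite _

/-- The orthogonal projector onto the code space. -/
def projector : Op n := (Fintype.card C.group : ℂ)⁻¹ • ∑ s : C.group, ((s : (Op n)ˣ) : Op n)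

theorem card_group_ne_zero : (Fintype.card C.group : ℂ) ≠ 0 :=
  Nat.cast_ne_zero.2 Fintype.card_ne_zero

theorem stabilizer_mul_projector {s : (Op n)ˣ} (hs : s ∈ C.group) :
    (s : Op n) * C.projector = C.projector := by
  rw [projector, mul_smul_comm, Finset.mul_sum]
  congr 1
  exact Fintype.sum_equiv (Equiv.mulLeft (⟨s, hs⟩ : C.group)) _ _ fun s' => by simp

theorem projector_isHermitian : C.projectorᴴ = C.projector := by
  rw [projector, Matrix.conjTranspose_smul, Matrix.conjTranspose_sum]
  congr 1
  · simp
  · exact Finset.sum_congr rfl fun s _ => C.stabilizer_conjTranspose s.2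

theorem projector_mul_stabilizer {s : (Op n)ˣ} (hs : s ∈ C.group) :
    C.projector * (s : Op n) = C.projector := by
  have := congrArg Matrix.conjTranspose (C.stabilizer_mul_projector hs)
  rwa [Matrix.conjTranspose_mul, C.projector_isHermitian, C.stabilizer_conjTranspose hs] at this

theorem projector_mul_self : C.projector * C.projector = C.projector := by
  conv_lhs => enter [1]; rw [projector]
  rw [smul_mul_assoc, Finset.sum_mul,
    Finset.sum_congr rfl fun s _ => C.stabilizer_mul_projector s.2, Finset.sum_const,
    Finset.card_univ, ← Nat.cast_smul_eq_nsmul ℂ, smul_smul,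
    inv_mul_cancel₀ C.card_group_ne_zero, one_smul]

theorem mem_codeSpace_iff {v : Ket n} : v ∈ C.codeSpace ↔ C.projector *ᵥ v = v := by
  refine ⟨fun h => ?_, fun h s hs => ?_⟩
  · rw [projector, Matrix.smul_mulVec, Matrix.sum_mulVec,
      Finset.sum_congr rfl fun (s : C.group) _ => h s s.2, Finset.sum_const,
      Finset.card_univ, ← Nat.cast_smul_eq_nsmul ℂ, smul_smul,
      inv_mul_cancel₀ C.card_group_ne_zero, one_smul]
  · rw [← h, Matrix.mulVec_mulVec, C.stabilizer_mul_projector hs]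

theorem projector_mulVec_mem (v : Ket n) : C.projector *ᵥ v ∈ C.codeSpace := by
  rw [mem_codeSpace_iff, Matrix.mulVec_mulVec, projector_mul_self]

theorem forall_mulVec_mem_codeSpace_iff {A : Op n} :
    (∀ v, A *ᵥ v ∈ C.codeSpace) ↔ C.projector * A = A := by
  simp only [mem_codeSpace_iff, Matrix.mulVec_mulVec]
  exact ⟨fun h => Matrix.ext_of_mulVec_single fun i => h _, fun h v => by rw [h]⟩

theorem supportsOp_iff {A : Op n} :
    C.SupportsOp A ↔ C.projector * A = A ∧ A * C.projector = A := by
  rw [SupportsOp, forall_mulVec_mem_codeSpace_iff, forall_mulVec_mem_codeSpace_iff]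
  refine and_congr_right fun _ => ?_
  rw [← Matrix.conjTranspose_inj, Matrix.conjTranspose_mul, Matrix.conjTranspose_conjTranspose,
    projector_isHermitian]

theorem trace_projector : C.projector.trace = Module.finrank ℂ C.codeSpace := by
  have h : LinearMap.IsProj C.codeSpace (Matrix.toLin' C.projector) :=
    ⟨fun v => by simpa using C.projector_mulVec_mem v,
      fun v hv => by simpa using C.mem_codeSpace_iff.1 hv⟩
  rw [← h.trace, Matrix.trace_toLin'_eq]

/-! ### Logical operators and error detection -/

theorem commute_projector_of_forall {A : Op n}
    (hA : ∀ s ∈ C.group, Commute A (s : Op n)) : Commute A C.projector :=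
  (Commute.sum_right _ (fun s : C.group => ((s : (Op n)ˣ) : Op n)) _
    fun s _ => hA s.1 s.2).smul_right _

/-- Both projectors absorb `s`, and moving `s` across `A` flips the sign, so the compression equals
its own negative. -/
theorem projector_mul_mul_projector_eq_zero {A : Op n} {s : (Op n)ˣ} (hs : s ∈ C.group)
    (h : A * s = -(s * A)) : C.projector * A * C.projector = 0 := by
  have key : C.projector * A * C.projector = -(C.projector * A * C.projector) := by
    calc C.projector * A * C.projector = C.projector * (A * s) * C.projector := by
          rw [mul_assoc, mul_assoc, mul_assoc A, C.stabilizer_mul_projector hs]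
      _ = -(C.projector * A * C.projector) := by
          rw [h, mul_neg, neg_mul, ← mul_assoc, C.projector_mul_stabilizer hs]
  ext x y
  exact self_eq_neg.1 (congrFun₂ key x y)

theorem commute_or_projector_mul_mul_projector_eq_zero {A : Op n}
    (hA : ∀ s ∈ C.group, Commute A (s : Op n) ∨ A * s = -(s * A)) :
    Commute A C.projector ∨ C.projector * A * C.projector = 0 := by
  by_cases h : ∃ s ∈ C.group, A * s = -(s * A)
  · obtain ⟨s, hs, h⟩ := h
    exact Or.inr (C.projector_mul_mul_projector_eq_zero hs h)
  · push Not at h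
    exact Or.inl (C.commute_projector_of_forall fun s hs => (hA s hs).resolve_right (h s hs))

theorem pauliOp_commute_or (P : Fin n → Pauli) {s : (Op n)ˣ} (hs : s ∈ C.group) :
    Commute (pauliOp P) (s : Op n) ∨ pauliOp P * s = -(s * pauliOp P) := by
  obtain ⟨c, P', -, h⟩ := C.exists_eq_smul_pauliOp hs
  rw [h]
  refine (pauliOp_mul_comm P P').imp (fun h => h.smul_right c) fun h => ?_
  rw [mul_smul_comm, h, smul_mul_assoc, smul_neg]

/-- A Pauli operator as an element of the unit group. -/
def pauliUnit (P : Fin n → Pauli) : (Op n)ˣ :=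
  ⟨pauliOp P, pauliOp P, pauliOp_mul_self P, pauliOp_mul_self P⟩

theorem pauliUnit_mem_normalizer_of_forall {P : Fin n → Pauli}
    (h : ∀ s ∈ C.group, Commute (pauliOp P) (s : Op n)) :
    pauliUnit P ∈ Subgroup.normalizer (C.group : Set (Op n)ˣ) := by
  exact Subgroup.centralizer_le_normalizer _ <| Subgroup.mem_centralizer_iff.2 fun s hs =>
    Units.ext (h s hs).eq.symm

variable {C}

/-- Conjugation by a Pauli operator sends `s` to `±s`. The minus sign would put both `s` and `-s`,
hence `-1`, in the group, so normalizing amounts to centralizing. -/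
theorem IsLogical.commute_stabilizer {P : Fin n → Pauli} (hP : C.IsLogical P) {s : (Op n)ˣ}
    (hs : s ∈ C.group) : Commute (pauliOp P) (s : Op n) := by
  obtain ⟨⟨u, hu, hmem⟩, -⟩ := hP
  refine (C.pauliOp_commute_or P hs).resolve_right fun hanti => C.neg_one ?_
  have hconj : u * s * u⁻¹ = -s := by
    rw [mul_inv_eq_iff_eq_mul]
    ext1
    rw [Units.val_mul, Units.val_mul, Units.val_neg, hu, hanti, neg_mul]
  have h := (Subgroup.mem_normalizer_iff.1 hmem s).1 hs
  rw [hconj] at h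
  simpa using C.group.mul_mem h (C.group.inv_mem hs)

theorem IsLogical.commute_projector {P : Fin n → Pauli} (hP : C.IsLogical P) :
    Commute (pauliOp P) C.projector :=
  C.commute_projector_of_forall fun _ hs => hP.commute_stabilizer hs

/-- Distinct Pauli strings are trace-orthogonal, and the string of a logical operator occurs in no
stabilizer. -/
theorem IsLogical.trace_projector_mul {P : Fin n → Pauli} (hP : C.IsLogical P) :
    (C.projector * pauliOp P).trace = 0 := by
  rw [projector, smul_mul_assoc, Matrix.trace_smul, Finset.sum_mul, Matrix.trace_sum,
    Finset.sum_eq_zero, smul_zero]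
  intro s _
  obtain ⟨c, P', -, h⟩ := C.exists_eq_smul_pauliOp s.2
  have hne : P' ≠ P := by
    rintro rfl
    exact hP.2 c ⟨s, s.2, h⟩
  rw [h, smul_mul_assoc, Matrix.trace_smul, trace_pauliOp_mul_of_ne hne, smul_zero]

/-- Two cases: if the string commutes with the whole group it must be a stabilizer up to a scalar,
and acts as that scalar's inverse; otherwise it anticommutes with some stabilizer and the
compression vanishes. -/
theorem exists_projector_mul_mul_projector_of_not_isLogical {P : Fin n → Pauli}
    (hP : ¬ C.IsLogical P) : ∃ c : ℂ, C.projector * pauliOp P * C.projector = c • C.projector := by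
  by_cases hc : ∀ s ∈ C.group, Commute (pauliOp P) (s : Op n)
  · have h : ∃ c : ℂ, C.IsStabilizer (c • pauliOp P) := by
      by_contra! hcon
      exact hP ⟨⟨pauliUnit P, rfl, C.pauliUnit_mem_normalizer_of_forall hc⟩, hcon⟩
    obtain ⟨c, s, hs, h⟩ := h
    have hc0 : c ≠ 0 := by
      rintro rfl
      exact s.ne_zero (by rw [h, zero_smul])
    refine ⟨c⁻¹, ?_⟩
    have h1 := C.projector_mul_stabilizer hs
    rw [h, mul_smul_comm, ← eq_inv_smul_iff₀ hc0] at h1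
    rw [h1, smul_mul_assoc, projector_mul_self]
  · push Not at hc
    obtain ⟨s, hs, hs'⟩ := hc
    exact ⟨0, by rw [zero_smul, C.projector_mul_mul_projector_eq_zero hs
      ((C.pauliOp_commute_or P hs).resolve_left hs')]⟩

/-- The error detection condition: a code of distance `k + 1` detects all `k`-local errors. -/
theorem exists_projector_mul_mul_projector_of_isLocal {k : ℕ}
    (hC : ∀ P, C.IsLogical P → k < weight P) {A : Op n} (hA : IsLocal k A) :
    ∃ c : ℂ, C.projector * A * C.projector = c • C.projector := by
  let p : Submodule ℂ (Op n) :=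
    { carrier := {A | ∃ c : ℂ, C.projector * A * C.projector = c • C.projector}
      add_mem' := by
        rintro A B ⟨c, hc⟩ ⟨d, hd⟩
        exact ⟨c + d, by rw [mul_add, add_mul, hc, hd, add_smul]⟩
      zero_mem' := ⟨0, by simp⟩
      smul_mem' := by
        rintro a A ⟨c, hc⟩
        exact ⟨a * c, by rw [mul_smul_comm, smul_mul_assoc, hc, smul_smul]⟩ }
  exact hA.induction_pauli p fun P hP =>
    exists_projector_mul_mul_projector_of_not_isLogical fun h => (hC P h).not_ge hP

end StabilizerCode

/-! ### Existence of a recovery -/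

theorem exists_smul_star_dotProduct_self {ι : Type*} [Fintype ι] {v : ι → ℂ} (hv : v ≠ 0) :
    ∃ c : ℂ, c ≠ 0 ∧ star (c • v) ⬝ᵥ (c • v) = 1 := by
  have hpos : 0 < star v ⬝ᵥ v := Matrix.dotProduct_star_self_pos_iff.2 hv
  obtain ⟨r, hr⟩ : ∃ r : ℝ, star v ⬝ᵥ v = r := ⟨_, (Complex.ext rfl (Complex.pos_iff.1 hpos).2.symm)⟩
  have hr0 : 0 < r := by rw [hr] at hpos; exact_mod_cast hpos
  refine ⟨((√r)⁻¹ : ℝ), by simpa using (Real.sqrt_pos.2 hr0).ne', ?_⟩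
  rw [star_smul, smul_dotProduct, dotProduct_smul, hr, smul_smul, smul_eq_mul, Complex.star_def,
    Complex.conj_ofReal, ← Complex.ofReal_mul, ← Complex.ofReal_mul, ← mul_inv,
    Real.mul_self_sqrt hr0.le, inv_mul_cancel₀ hr0.ne', Complex.ofReal_one]

theorem isChannel_of_fintype {n : ℕ} {ι : Type*} [Fintype ι] (K : ι → Op n)
    (hK : ∑ a, (K a)ᴴ * K a = 1) : IsChannel fun A => ∑ a, K a * A * (K a)ᴴ := by
  let e := Fintype.equivFin ι
  refine ⟨Fintype.card ι, fun a => K (e.symm a), ?_, fun A => ?_⟩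
  · rw [← hK]
    exact Fintype.sum_equiv e.symm _ _ fun _ => rfl
  · exact Fintype.sum_equiv e _ _ fun _ => by simp

theorem sum_vecMulVec_single {ι : Type*} [Fintype ι] [DecidableEq ι] :
    ∑ x : ι, Matrix.vecMulVec (Pi.single x (1 : ℂ)) (Pi.single x 1) = 1 := by
  ext i j
  simp only [Matrix.sum_apply, Matrix.vecMulVec_apply, Matrix.one_apply, Pi.single_apply]
  simp

namespace StabilizerCode

variable {n : ℕ} (C : StabilizerCode n)

/-- The projector onto the code space displaced by the Pauli error `p` on qubit `i`. -/
def errorProjector (x : Fin n × Pauli) : Op n :=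
  onQubit x.1 x.2.mat * C.projector * onQubit x.1 x.2.mat

theorem onQubit_pauli_mul_self (x : Fin n × Pauli) :
    onQubit x.1 x.2.mat * onQubit x.1 x.2.mat = 1 := by
  rw [onQubit_mul, Pauli.mat_mul_self, onQubit_one]

theorem onQubit_pauli_isHermitian (x : Fin n × Pauli) :
    (onQubit x.1 x.2.mat)ᴴ = onQubit x.1 x.2.mat := by
  rw [onQubit_conjTranspose, Pauli.mat_conjTranspose]

theorem errorProjector_isHermitian (x : Fin n × Pauli) :
    (C.errorProjector x)ᴴ = C.errorProjector x := by
  rw [errorProjector, Matrix.conjTranspose_mul, Matrix.conjTranspose_mul,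
    onQubit_pauli_isHermitian, projector_isHermitian, mul_assoc]

theorem errorProjector_mul_error_mul_projector (x : Fin n × Pauli) :
    C.errorProjector x * (onQubit x.1 x.2.mat * C.projector) =
      onQubit x.1 x.2.mat * C.projector := by
  rw [errorProjector, mul_assoc, ← mul_assoc (onQubit _ _) (onQubit _ _), onQubit_pauli_mul_self,
    one_mul, mul_assoc, projector_mul_self]

theorem errorProjector_mul_self (x : Fin n × Pauli) :
    C.errorProjector x * C.errorProjector x = C.errorProjector x := by
  conv_lhs => enter [2]; rw [errorProjector]
  rw [← mul_assoc, errorProjector_mul_error_mul_projector, errorProjector]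

/-- The product `E * F` of the two errors commutes or anticommutes with each stabilizer. If it
commutes with all of them the displaced spaces agree; otherwise its compression vanishes and they
are orthogonal. Different errors can give the same space, for instance in degenerate codes, so the
sums below run over the range of `errorProjector` and not over pairs of qubit and letter. -/
theorem errorProjector_eq_or_mul_eq_zero (x y : Fin n × Pauli) :
    C.errorProjector x = C.errorProjector y ∨ C.errorProjector x * C.errorProjector y = 0 := by
  set E := onQubit x.1 x.2.mat with hE
  set F := onQubit y.1 y.2.mat with hF
  have hE1 : E * E = 1 := onQubit_pauli_mul_self x
  have hF1 : F * F = 1 := onQubit_pauli_mul_self y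
  have hcomm : ∀ s ∈ C.group, Commute (E * F) (s : Op n) ∨ E * F * s = -(s * (E * F)) := by
    intro s hs
    have h1 := C.pauliOp_commute_or (Function.update (fun _ => Pauli.I) x.1 x.2) hs
    have h2 := C.pauliOp_commute_or (Function.update (fun _ => Pauli.I) y.1 y.2) hs
    rw [← onQubit_pauli] at h1 h2
    rw [← hE] at h1
    rw [← hF] at h2
    rcases h1 with h1 | h1 <;> rcases h2 with h2 | h2
    · exact Or.inl (h1.mul_left h2)
    · right
      rw [mul_assoc, h2, mul_neg, ← mul_assoc, h1.eq, mul_assoc]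
    · right
      rw [mul_assoc, h2.eq, ← mul_assoc, h1, neg_mul, mul_assoc]
    · left
      rw [Commute, SemiconjBy, mul_assoc, h2, mul_neg, ← mul_assoc, h1, neg_mul, neg_neg,
        mul_assoc]
  rcases C.commute_or_projector_mul_mul_projector_eq_zero hcomm with h | h
  · left
    change E * C.projector * E = F * C.projector * F
    calc E * C.projector * E = E * C.projector * (E * (F * F)) := by rw [hF1, mul_one]
      _ = E * (C.projector * (E * F)) * F := by simp only [mul_assoc]
      _ = (E * E) * F * C.projector * F := by rw [← h.eq]; simp only [mul_assoc]
      _ = F * C.projector * F := by rw [hE1, one_mul]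
  · right
    change E * C.projector * E * (F * C.projector * F) = 0
    calc E * C.projector * E * (F * C.projector * F)
        = E * (C.projector * (E * F) * C.projector) * F := by simp only [mul_assoc]
      _ = 0 := by rw [h, mul_zero, zero_mul]

instance : Fintype (Set.range C.errorProjector) := Fintype.ofFinite _

/-- The projector onto the span of the code space displaced by all single-qubit errors. -/
def correctableProjector : Op n := ∑ p : Set.range C.errorProjector, (p : Op n)

theorem mul_eq_zero_of_mem_range {p q : Set.range C.errorProjector} (h : p ≠ q) :
    (p : Op n) * q = 0 := by
  obtain ⟨_, x, rfl⟩ := p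
  obtain ⟨_, y, rfl⟩ := q
  exact (C.errorProjector_eq_or_mul_eq_zero x y).resolve_left fun h' => h (Subtype.ext h')

theorem correctableProjector_mul (p : Set.range C.errorProjector) :
    C.correctableProjector * (p : Op n) = p := by
  rw [correctableProjector, Finset.sum_mul, Fintype.sum_eq_single p fun q hq =>
    C.mul_eq_zero_of_mem_range hq]
  obtain ⟨_, x, rfl⟩ := p
  exact C.errorProjector_mul_self x

theorem correctableProjector_mul_self :
    C.correctableProjector * C.correctableProjector = C.correctableProjector := by
  conv_lhs => enter [2]; rw [correctableProjector]
  rw [Finset.mul_sum, Finset.sum_congr rfl fun p _ => C.correctableProjector_mul p]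
  rfl

theorem correctableProjector_isHermitian :
    C.correctableProjectorᴴ = C.correctableProjector := by
  rw [correctableProjector, Matrix.conjTranspose_sum]
  refine Finset.sum_congr rfl ?_
  rintro ⟨_, x, rfl⟩ _
  exact C.errorProjector_isHermitian x

theorem correctableProjector_mul_onQubit_mul_projector (i : Fin n)
    (B : Matrix (Fin 2) (Fin 2) ℂ) :
    C.correctableProjector * (onQubit i B * C.projector) = onQubit i B * C.projector := by
  have hp : ∀ p : Pauli, C.correctableProjector * (onQubit i p.mat * C.projector) =
      onQubit i p.mat * C.projector := by
    intro p
    rw [← C.errorProjector_mul_error_mul_projector (i, p), ← mul_assoc,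
      C.correctableProjector_mul ⟨_, (i, p), rfl⟩]
  rw [← sum_pauliCoeff_smul B, Pauli.sum_univ]
  simp only [onQubit_add, onQubit_smul, add_mul, mul_add, smul_mul_assoc, mul_smul_comm, hp]

/-- The Kraus operators of the standard recovery: undo the error on each of the displaced code
spaces, and map their orthogonal complement to the fixed code vector `v`. -/
def recoveryKraus (v : Ket n) : Set.range C.errorProjector ⊕ Basis n → Op n
  | .inl p => C.projector * onQubit p.2.choose.1 p.2.choose.2.mat
  | .inr x => Matrix.vecMulVec v (Pi.single x 1) * (1 - C.correctableProjector)

/-- The first family contributes `correctableProjector`; the second contributes its complement,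
because `v` is a unit vector. -/
theorem sum_recoveryKraus {v : Ket n} (hv : star v ⬝ᵥ v = 1) :
    ∑ a, (C.recoveryKraus v a)ᴴ * C.recoveryKraus v a = 1 := by
  have hinl : ∀ p : Set.range C.errorProjector,
      (C.recoveryKraus v (.inl p))ᴴ * C.recoveryKraus v (.inl p) = p := by
    intro p
    rw [recoveryKraus, Matrix.conjTranspose_mul, projector_isHermitian, onQubit_pauli_isHermitian,
      mul_assoc, ← mul_assoc C.projector, projector_mul_self, ← mul_assoc]
    exact p.2.choose_spec
  have hinr : ∀ x : Basis n, (C.recoveryKraus v (.inr x))ᴴ * C.recoveryKraus v (.inr x) =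
      (1 - C.correctableProjector) *
        Matrix.vecMulVec (Pi.single x (1 : ℂ)) (Pi.single x 1) * (1 - C.correctableProjector) := by
    intro x
    rw [recoveryKraus, Matrix.conjTranspose_mul, Matrix.conjTranspose_sub,
      correctableProjector_isHermitian, Matrix.conjTranspose_one, Matrix.conjTranspose_vecMulVec,
      mul_assoc, ← mul_assoc (Matrix.vecMulVec _ _), Matrix.vecMulVec_mul_vecMulVec, hv, one_smul,
      ← mul_assoc, Pi.star_single, star_one]
  rw [Fintype.sum_sum_type, Finset.sum_congr rfl fun p _ => hinl p,
    Finset.sum_congr rfl fun x _ => hinr x, ← Finset.sum_mul, ← Finset.mul_sum,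
    sum_vecMulVec_single, mul_one, mul_sub, mul_one, sub_mul, one_mul,
    correctableProjector_mul_self, sub_self, sub_zero, ← correctableProjector, add_sub_cancel]

theorem projector_mul_recoveryKraus {v : Ket n} (hv : v ∈ C.codeSpace)
    (a : Set.range C.errorProjector ⊕ Basis n) :
    C.projector * C.recoveryKraus v a = C.recoveryKraus v a := by
  rcases a with p | x
  · rw [recoveryKraus, ← mul_assoc, projector_mul_self]
  · rw [recoveryKraus, ← mul_assoc, Matrix.mul_vecMulVec, C.mem_codeSpace_iff.1 hv]

/-- This is the Knill-Laflamme condition: a Pauli correction times a single-qubit error is 2-local,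
hence detectable, and the remaining Kraus operators annihilate the correctable space. -/
theorem exists_recoveryKraus_mul (hC : ∀ P, C.IsLogical P → 2 < weight P) (v : Ket n) {B : Op n}
    (hB : IsSingleQubit B) (a : Set.range C.errorProjector ⊕ Basis n) :
    ∃ c : ℂ, C.recoveryKraus v a * B * C.projector = c • C.projector := by
  obtain ⟨i, B, rfl⟩ := hB
  rcases a with p | x
  · obtain ⟨c, hc⟩ := exists_projector_mul_mul_projector_of_isLocal hC
      (isLocal_two_onQubit_mul_onQubit p.2.choose.1 i p.2.choose.2.mat B)
    exact ⟨c, by rw [← hc, recoveryKraus]; simp only [mul_assoc]⟩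
  · refine ⟨0, ?_⟩
    rw [recoveryKraus, mul_assoc, mul_assoc, sub_mul, one_mul,
      correctableProjector_mul_onQubit_mul_projector, sub_self, mul_zero, zero_smul]

theorem exists_unit_mem_codeSpace (hdim : Module.finrank ℂ C.codeSpace ≠ 0) :
    ∃ v ∈ C.codeSpace, star v ⬝ᵥ v = 1 := by
  have : Nontrivial C.codeSpace := Module.nontrivial_of_finrank_pos (Nat.pos_of_ne_zero hdim)
  obtain ⟨v, hv⟩ := exists_ne (0 : C.codeSpace)
  obtain ⟨c, -, hc⟩ := exists_smul_star_dotProduct_self (v := (v : Ket n)) (by simpa using hv)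
  exact ⟨c • (v : Ket n), C.codeSpace.smul_mem c v.2, hc⟩

theorem exists_isRecovery (hdim : Module.finrank ℂ C.codeSpace ≠ 0)
    (hC : ∀ P, C.IsLogical P → 2 < weight P) : ∃ R : Op n → Op n, IsRecovery C R := by
  obtain ⟨v, hv, hv1⟩ := C.exists_unit_mem_codeSpace hdim
  refine ⟨_, isChannel_of_fintype _ (C.sum_recoveryKraus hv1), fun A => ?_, fun B hB => ?_⟩
  · rw [supportsOp_iff, Finset.mul_sum, Finset.sum_mul]
    constructor <;> refine Finset.sum_congr rfl fun a _ => ?_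
    · rw [← mul_assoc, ← mul_assoc, C.projector_mul_recoveryKraus hv]
    · have := congrArg Matrix.conjTranspose (C.projector_mul_recoveryKraus hv a)
      rw [Matrix.conjTranspose_mul, projector_isHermitian] at this
      rw [mul_assoc, this]
  · choose c hc using fun a => C.exists_recoveryKraus_mul hC v hB a
    refine ⟨∑ a, c a * star (c a), fun A hA => ?_⟩
    rw [supportsOp_iff] at hA
    rw [Finset.sum_smul]
    refine Finset.sum_congr rfl fun a _ => ?_
    have h1 : C.recoveryKraus v a * B * A = c a • A := by
      rw [← hA.1, ← mul_assoc, hc, smul_mul_assoc]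
    have h2 : A * (C.recoveryKraus v a * B)ᴴ = star (c a) • A := by
      have := congrArg Matrix.conjTranspose (hc a)
      rw [Matrix.conjTranspose_mul, projector_isHermitian, Matrix.conjTranspose_smul,
        projector_isHermitian] at this
      conv_lhs => rw [← hA.2]
      rw [mul_assoc, this, mul_smul_comm, hA.2]
    calc C.recoveryKraus v a * (B * A * Bᴴ) * (C.recoveryKraus v a)ᴴ
        = C.recoveryKraus v a * B * A * (C.recoveryKraus v a * B)ᴴ := by
          rw [Matrix.conjTranspose_mul]; simp only [mul_assoc]
      _ = (c a * star (c a)) • A := by rw [h1, smul_mul_assoc, h2, smul_smul]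

end StabilizerCode

variable {n : ℕ}

/-! ### The action of a recovery -/

theorem IsChannel.exists_linearMap {R : Op n → Op n} (hR : IsChannel R) :
    ∃ Φ : Op n →ₗ[ℂ] Op n, R = Φ := by
  obtain ⟨r, K, -, hK⟩ := hR
  refine ⟨∑ a, LinearMap.mulRight ℂ (K a)ᴴ ∘ₗ LinearMap.mulLeft ℂ (K a), funext fun A => ?_⟩
  simp [hK, LinearMap.sum_apply]

theorem IsChannel.trace_apply {R : Op n → Op n} (hR : IsChannel R) (A : Op n) :
    (R A).trace = A.trace := by
  obtain ⟨r, K, hK1, hK⟩ := hR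
  rw [hK, Matrix.trace_sum]
  simp only [Matrix.trace_mul_comm (_ * A), ← mul_assoc]
  rw [← Matrix.trace_sum, ← Finset.sum_mul, hK1, one_mul]

theorem IsChannel.apply_conjTranspose {R : Op n → Op n} (hR : IsChannel R) (A : Op n) :
    R Aᴴ = (R A)ᴴ := by
  obtain ⟨r, K, -, hK⟩ := hR
  simp only [hK, Matrix.conjTranspose_sum, Matrix.conjTranspose_mul,
    Matrix.conjTranspose_conjTranspose, mul_assoc]

namespace StabilizerCode

variable {C : StabilizerCode n}

theorem supportsOp_projector : C.SupportsOp C.projector :=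
  C.supportsOp_iff.2 ⟨C.projector_mul_self, C.projector_mul_self⟩

theorem SupportsOp.conjTranspose {A : Op n} (hA : C.SupportsOp A) : C.SupportsOp Aᴴ :=
  ⟨hA.2, by simpa using hA.1⟩

theorem SupportsOp.mul {A B : Op n} (hA : C.SupportsOp A) (hB : C.SupportsOp B) :
    C.SupportsOp (A * B) := by
  rw [supportsOp_iff] at *
  exact ⟨by rw [← mul_assoc, hA.1], by rw [mul_assoc, hB.2]⟩

theorem SupportsOp.projector_mul {A : Op n} (hA : C.SupportsOp A) : C.projector * A = A :=
  (C.supportsOp_iff.1 hA).1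

theorem SupportsOp.mul_projector {A : Op n} (hA : C.SupportsOp A) : A * C.projector = A :=
  (C.supportsOp_iff.1 hA).2

theorem SupportsOp.sub {A B : Op n} (hA : C.SupportsOp A) (hB : C.SupportsOp B) :
    C.SupportsOp (A - B) :=
  C.supportsOp_iff.2 ⟨by rw [mul_sub, hA.projector_mul, hB.projector_mul],
    by rw [sub_mul, hA.mul_projector, hB.mul_projector]⟩

theorem supportsOp_projector_mul_mul (X : Op n) :
    C.SupportsOp (C.projector * X * C.projector) :=
  C.supportsOp_iff.2 ⟨by rw [← mul_assoc, ← mul_assoc, projector_mul_self],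
    by rw [mul_assoc, projector_mul_self]⟩

end StabilizerCode

namespace IsRecovery

variable {C : StabilizerCode n} {R : Op n → Op n}

theorem apply_of_supportsOp (hR : IsRecovery C R) (i : Fin n) (htr : C.projector.trace ≠ 0)
    {A : Op n} (hA : C.SupportsOp A) : R A = A := by
  obtain ⟨c, hc⟩ := hR.2.2 1 ⟨i, 1, (onQubit_one i).symm⟩
  simp only [Matrix.conjTranspose_one, mul_one, one_mul] at hc
  -- Trace preservation, tested on the projector itself, fixes the scalar attached to the identity
  -- error.
  have hc1 : c = 1 := by
    have h := hR.1.trace_apply C.projector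
    rw [hc _ C.supportsOp_projector, Matrix.trace_smul, smul_eq_mul] at h
    exact (mul_eq_right₀ htr).1 h
  rw [hc A hA, hc1, one_smul]

/-- The Kraus operators of a channel that fixes all operators on the code space act on it as
scalars; this is expressed here by their commuting with all operators on the code space. -/
theorem kraus_mul_eq {r : ℕ} {K : Fin r → Op n}
    (hfix : ∀ A, C.SupportsOp A → ∑ a, K a * A * (K a)ᴴ = A) {A : Op n} (hA : C.SupportsOp A)
    (a : Fin r) : K a * A = A * K a * C.projector := by
  have hA' := hA.conjTranspose
  -- The four parts of the expansion sum to `A * Aᴴ` with signs `+`, `-`, `-`, `+`, since the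
  -- channel fixes `A * Aᴴ`, `A`, `Aᴴ` and the projector. The summands are positive semidefinite, so
  -- a vanishing total trace makes each of them vanish.
  have hsum : ∑ a, (K a * A - A * K a * C.projector) * (K a * A - A * K a * C.projector)ᴴ = 0 := by
    have hexp : ∀ a, (K a * A - A * K a * C.projector) * (K a * A - A * K a * C.projector)ᴴ =
        K a * (A * Aᴴ) * (K a)ᴴ - (K a * A * (K a)ᴴ) * Aᴴ - A * (K a * Aᴴ * (K a)ᴴ) +
          A * (K a * C.projector * (K a)ᴴ) * Aᴴ := by
      intro a
      rw [Matrix.conjTranspose_sub, Matrix.conjTranspose_mul, Matrix.conjTranspose_mul,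
        Matrix.conjTranspose_mul, C.projector_isHermitian, sub_mul, mul_sub, mul_sub]
      have e1 : K a * A * (C.projector * ((K a)ᴴ * Aᴴ)) = K a * A * (K a)ᴴ * Aᴴ := by
        rw [← mul_assoc, mul_assoc (K a), hA.mul_projector, mul_assoc (K a * A)]
      have e2 : A * K a * C.projector * (Aᴴ * (K a)ᴴ) = A * (K a * Aᴴ * (K a)ᴴ) := by
        rw [← mul_assoc, mul_assoc _ C.projector, hA'.projector_mul]
        simp only [mul_assoc]
      have e3 : A * K a * C.projector * (C.projector * ((K a)ᴴ * Aᴴ)) =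
          A * (K a * C.projector * (K a)ᴴ) * Aᴴ := by
        rw [mul_assoc (A * K a), ← mul_assoc C.projector, C.projector_mul_self]
        simp only [mul_assoc]
      rw [e1, e2, e3]
      simp only [mul_assoc]
      abel
    rw [Finset.sum_congr rfl fun a _ => hexp a, Finset.sum_add_distrib, Finset.sum_sub_distrib,
      Finset.sum_sub_distrib, ← Finset.sum_mul, ← Finset.mul_sum, ← Finset.sum_mul,
      ← Finset.mul_sum, hfix _ (hA.mul hA'), hfix _ hA, hfix _ hA', hfix _ C.supportsOp_projector,
      hA.mul_projector]
    abel
  have hzero := congrArg Matrix.trace hsum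
  rw [Matrix.trace_sum, Matrix.trace_zero, Finset.sum_eq_zero_iff_of_nonneg fun a _ =>
    (Matrix.posSemidef_self_mul_conjTranspose _).trace_nonneg] at hzero
  exact sub_eq_zero.1 (Matrix.trace_mul_conjTranspose_self_eq_zero_iff.1 (hzero a (Finset.mem_univ a)))

/-- A recovery projects a perturbation that acts from one side only. -/
theorem apply_mul (hR : IsRecovery C R) (i : Fin n) (htr : C.projector.trace ≠ 0)
    (X : Op n) {A : Op n} (hA : C.SupportsOp A) : R (X * A) = C.projector * X * A := by
  -- The adjoint Kraus operators act as scalars on the code space, so `A` can be pulled out on the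
  -- right.
  have hfact : ∀ {A : Op n}, C.SupportsOp A → R (X * A) = R (X * C.projector) * A := by
    intro A hA
    obtain ⟨r, K, -, hK⟩ := hR.1
    have hcomm : ∀ a, A * (K a)ᴴ = C.projector * (K a)ᴴ * A := by
      intro a
      have h := kraus_mul_eq (fun A hA => by rw [← hK]; exact hR.apply_of_supportsOp i htr hA)
        hA.conjTranspose a
      have := congrArg Matrix.conjTranspose h
      rwa [Matrix.conjTranspose_mul, Matrix.conjTranspose_mul, Matrix.conjTranspose_mul,
        Matrix.conjTranspose_conjTranspose, C.projector_isHermitian, ← mul_assoc] at this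
    rw [hK, hK, Finset.sum_mul]
    refine Finset.sum_congr rfl fun a _ => ?_
    rw [mul_assoc, mul_assoc, hcomm]
    simp only [mul_assoc]
  -- The difference `D` is a code operator, so `hfact` applies to `Dᴴ` and gives `tr(D Dᴴ) = tr R(X
  -- Dᴴ) - tr(X Dᴴ)`, which is zero by trace preservation.
  have hD : R (X * C.projector) - C.projector * X * C.projector = 0 := by
    set D := R (X * C.projector) - C.projector * X * C.projector with hDdef
    have hDs : C.SupportsOp D := (hR.2.1 _).sub (C.supportsOp_projector_mul_mul X)
    rw [← Matrix.trace_mul_conjTranspose_self_eq_zero_iff]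
    conv_lhs => rw [hDdef]
    rw [sub_mul, ← hfact hDs.conjTranspose, Matrix.trace_sub, hR.1.trace_apply,
      mul_assoc, mul_assoc, Matrix.trace_mul_comm C.projector, mul_assoc,
      mul_assoc C.projector, hDs.conjTranspose.mul_projector, hDs.conjTranspose.projector_mul,
      sub_self]
  rw [hfact hA, sub_eq_zero.1 hD, mul_assoc, hA.projector_mul]

theorem apply_mul' (hR : IsRecovery C R) (i : Fin n) (htr : C.projector.trace ≠ 0)
    (X : Op n) {A : Op n} (hA : C.SupportsOp A) : R (A * X) = A * X * C.projector := by
  have h := hR.1.apply_conjTranspose (Xᴴ * Aᴴ)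
  rw [Matrix.conjTranspose_mul, Matrix.conjTranspose_conjTranspose,
    Matrix.conjTranspose_conjTranspose, hR.apply_mul i htr _ hA.conjTranspose] at h
  rw [h]
  simp only [Matrix.conjTranspose_mul, Matrix.conjTranspose_conjTranspose, C.projector_isHermitian,
    mul_assoc]

end IsRecovery

theorem StabilizerCode.SupportsOp.projector_mul_mul {C : StabilizerCode n} {A X : Op n} {c : ℂ}
    (hA : C.SupportsOp A) (hX : C.projector * X * C.projector = c • C.projector) :
    C.projector * X * A = c • A := by
  rw [← hA.projector_mul, ← mul_assoc, hX, smul_mul_assoc]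

theorem StabilizerCode.SupportsOp.mul_mul_projector {C : StabilizerCode n} {A X : Op n} {c : ℂ}
    (hA : C.SupportsOp A) (hX : C.projector * X * C.projector = c • C.projector) :
    A * X * C.projector = c • A := by
  conv_lhs => rw [← hA.mul_projector]
  rw [mul_assoc, mul_assoc, ← mul_assoc C.projector, hX, mul_smul_comm, hA.mul_projector]

/-- Detectable Hamiltonian terms are removed by the recovery. -/
theorem IsRecovery.apply_commutator_eq_zero {C : StabilizerCode n} {R : Op n → Op n}
    (hR : IsRecovery C R) (i : Fin n) (htr : C.projector.trace ≠ 0) {X : Op n} {c : ℂ}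
    (hX : C.projector * X * C.projector = c • C.projector) {A : Op n} (hA : C.SupportsOp A) :
    R (X * A - A * X) = 0 := by
  obtain ⟨Φ, rfl⟩ := hR.1.exists_linearMap
  rw [map_sub, hR.apply_mul i htr _ hA, hR.apply_mul' i htr _ hA, hA.projector_mul_mul hX,
    hA.mul_mul_projector hX, sub_self]

/-- The recovery cancels the dissipator of a single-qubit Lindblad operator to first order. -/
theorem IsRecovery.apply_dissipator_eq_zero {C : StabilizerCode n} {R : Op n → Op n}
    (hC : ∀ P, C.IsLogical P → 2 < weight P) (hR : IsRecovery C R)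
    (htr : C.projector.trace ≠ 0) {B : Op n} (hB : IsSingleQubit B)
    {A : Op n} (hA : C.SupportsOp A) :
    R (B * A * Bᴴ - (1 / 2 : ℂ) • (Bᴴ * B * A + A * (Bᴴ * B))) = 0 := by
  obtain ⟨c, hc⟩ := hR.2.2 B hB
  obtain ⟨i, B, rfl⟩ := hB
  obtain ⟨κ, hκ⟩ := C.exists_projector_mul_mul_projector_of_isLocal hC
    (A := (onQubit i B)ᴴ * onQubit i B)
    (by rw [onQubit_conjTranspose, onQubit_mul]; exact isLocal_two_onQubit _ _)
  -- On the projector, trace preservation balances the recovered jump term against the compression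
  -- of `Bᴴ * B`. This makes gain and loss cancel.
  have hcκ : c = κ := by
    have h1 := hR.1.trace_apply (onQubit i B * C.projector * (onQubit i B)ᴴ)
    rw [hc _ C.supportsOp_projector, ← C.projector_mul_self] at h1
    have h2 := congrArg Matrix.trace hκ
    rw [Matrix.trace_mul_comm, ← mul_assoc, ← mul_assoc, C.projector_mul_self] at h2
    rw [C.projector_mul_self, Matrix.trace_mul_comm, ← mul_assoc, Matrix.trace_mul_comm,
      ← mul_assoc, h2, Matrix.trace_smul, Matrix.trace_smul] at h1
    exact mul_right_cancel₀ htr h1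
  obtain ⟨Φ, rfl⟩ := hR.1.exists_linearMap
  rw [map_sub, map_smul, map_add, hR.apply_mul i htr _ hA, hR.apply_mul' i htr _ hA, hc A hA,
    hA.projector_mul_mul hκ, hA.mul_mul_projector hκ, hcκ]
  module

/-! ### The logical part of the Hamiltonian -/

/-- The diagonal of a `Z`-type Pauli string. -/
def zSign (P : Fin n → Pauli) (x : Basis n) : ℝ :=
  ∏ q, if P q = Pauli.Z ∧ x q = 1 then -1 else 1

theorem abs_zSign (P : Fin n → Pauli) (x : Basis n) : |zSign P x| = 1 := by
  rw [zSign, Finset.abs_prod]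
  exact Finset.prod_eq_one fun q _ => by split_ifs <;> simp

theorem zSign_zero (P : Fin n → Pauli) : zSign P 0 = 1 :=
  Finset.prod_eq_one fun q _ => by simp

theorem pauliOp_eq_diagonal {P : Fin n → Pauli} (hP : ∀ q, P q = Pauli.I ∨ P q = Pauli.Z) :
    pauliOp P = Matrix.diagonal fun x => (zSign P x : ℂ) := by
  ext x y
  rw [pauliOp, tensor_apply]
  by_cases hxy : x = y
  · subst hxy
    rw [Matrix.diagonal_apply_eq, zSign, Complex.ofReal_prod]
    refine Finset.prod_congr rfl fun q _ => ?_
    rcases hP q with h | h <;> rw [h] <;> generalize x q = b <;> fin_cases b <;>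
      simp [Pauli.mat]
  · obtain ⟨q, hq⟩ := Function.ne_iff.1 hxy
    rw [Matrix.diagonal_apply_ne _ hxy]
    refine Finset.prod_eq_zero (Finset.mem_univ q) ?_
    revert hq
    rcases hP q with h | h <;> rw [h] <;> generalize x q = b <;> generalize y q = b' <;>
      fin_cases b <;> fin_cases b' <;> simp [Pauli.mat]

theorem zzz_eq_I_or_Z (p : Fin n × Fin n × Fin n) (q : Fin n) :
    zzz p q = Pauli.I ∨ zzz p q = Pauli.Z := by
  rw [zzz]; split_ifs <;> simp

namespace StabilizerCode

variable (C : StabilizerCode n)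

open Classical in
/-- The triples `i < j < k` for which `Z_i Z_j Z_k` is a logical operator. -/
def logicalTriples : Finset (Fin n × Fin n × Fin n) :=
  (triples n).filter fun p => C.IsLogical (zzz p)

theorem card_logicalTriples : C.logicalTriples.card = numLogical C := rfl

/-- The diagonal of the sum of the logical terms of `G`. -/
def phase (x : Basis n) : ℝ := ∑ p ∈ C.logicalTriples, zSign (zzz p) x

/-- The sum of the logical terms of `G`. -/
def logicalG : Op n := Matrix.diagonal fun x => (C.phase x : ℂ)

theorem logicalG_eq_sum : C.logicalG = ∑ p ∈ C.logicalTriples, pauliOp (zzz p) := by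
  simp only [pauliOp_eq_diagonal (zzz_eq_I_or_Z _)]
  ext x y
  rw [Matrix.sum_apply, logicalG]
  by_cases hxy : x = y
  · subst hxy; simp [phase]
  · simp [Matrix.diagonal_apply_ne _ hxy]

theorem abs_phase_le (x : Basis n) : |C.phase x| ≤ numLogical C := by
  refine (Finset.abs_sum_le_sum_abs _ _).trans ?_
  simp [abs_zSign, card_logicalTriples]

theorem isLogical_of_mem_logicalTriples {p : Fin n × Fin n × Fin n}
    (hp : p ∈ C.logicalTriples) : C.IsLogical (zzz p) := by
  classical
  exact (Finset.mem_filter.1 hp).2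

theorem commute_logicalG_projector : Commute C.logicalG C.projector := by
  rw [logicalG_eq_sum]
  exact Commute.sum_left _ _ _ fun p hp =>
    (C.isLogical_of_mem_logicalTriples hp).commute_projector

theorem logicalG_isHermitian : C.logicalGᴴ = C.logicalG := by
  rw [logicalG, Matrix.diagonal_conjTranspose]
  congr 1
  ext x
  simp

/-- What remains of `G` consists of non-logical terms, each compressed to a scalar. These terms have
weight 3, so locality alone would not give this. -/
theorem exists_projector_mul_sub_logicalG_mul_projector :
    ∃ c : ℂ, C.projector * (G n - C.logicalG) * C.projector = c • C.projector := by
  classical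
  have h : ∀ p ∈ (triples n).filter fun p => ¬ C.IsLogical (zzz p), ∃ c : ℂ,
      C.projector * pauliOp (zzz p) * C.projector = c • C.projector := fun p hp =>
    exists_projector_mul_mul_projector_of_not_isLogical (Finset.mem_filter.1 hp).2
  choose! c hc using h
  refine ⟨∑ p ∈ (triples n).filter fun p => ¬ C.IsLogical (zzz p), c p, ?_⟩
  have hG : G n - C.logicalG =
      ∑ p ∈ (triples n).filter fun p => ¬ C.IsLogical (zzz p), pauliOp (zzz p) := by
    rw [sub_eq_iff_eq_add', logicalG_eq_sum, G, logicalTriples]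
    convert (Finset.sum_filter_add_sum_filter_not (triples n)
      (fun p => C.IsLogical (zzz p)) _).symm
  rw [hG, Finset.mul_sum, Finset.sum_mul, Finset.sum_smul]
  exact Finset.sum_congr rfl hc

end StabilizerCode

/-- To first order in time, the noisy evolution followed by the recovery is the unitary evolution
generated by the logical terms of the Hamiltonian. -/
theorem IsRecovery.apply_lindbladian {C : StabilizerCode n} {R : Op n → Op n}
    (hC : ∀ P, C.IsLogical P → 2 < weight P) (hR : IsRecovery C R) (i : Fin n)
    (htr : C.projector.trace ≠ 0) (E : Environment n) (ω : ℝ) {A : Op n} (hA : C.SupportsOp A) :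
    R (lindbladian E ω A) = (-Complex.I * ω) • (C.logicalG * A - A * C.logicalG) := by
  obtain ⟨c, hc⟩ := C.exists_projector_mul_sub_logicalG_mul_projector
  obtain ⟨d, hd⟩ := C.exists_projector_mul_mul_projector_of_isLocal hC E.twoLocal
  have h1 := hR.apply_commutator_eq_zero i htr hc hA
  have h2 := hR.apply_commutator_eq_zero i htr hd hA
  have h3 : R (C.logicalG * A - A * C.logicalG) = C.logicalG * A - A * C.logicalG := by
    refine hR.apply_of_supportsOp i htr (C.supportsOp_iff.2 ⟨?_, ?_⟩)
    · rw [mul_sub, ← mul_assoc, ← C.commute_logicalG_projector.eq, mul_assoc, ← mul_assoc _ A,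
        hA.projector_mul]
    · rw [sub_mul, mul_assoc, hA.mul_projector, mul_assoc, C.commute_logicalG_projector.eq,
        ← mul_assoc, hA.mul_projector]
  have h4 := fun a => hR.apply_dissipator_eq_zero hC htr (E.singleQubit a) hA
  -- The first two commutators come from detectable operators and are killed by the recovery; the
  -- last preserves the code space and is fixed by it.
  have hH : ((ω : ℂ) • G n + E.H₀) * A - A * ((ω : ℂ) • G n + E.H₀) =
      (ω : ℂ) • ((G n - C.logicalG) * A - A * (G n - C.logicalG)) + (E.H₀ * A - A * E.H₀) +
        (ω : ℂ) • (C.logicalG * A - A * C.logicalG) := by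
    simp only [add_mul, mul_add, sub_mul, mul_sub, smul_mul_assoc, mul_smul_comm]
    module
  obtain ⟨Φ, rfl⟩ := hR.1.exists_linearMap
  rw [lindbladian]
  simp only [hH]
  rw [map_add, map_sum, Finset.sum_eq_zero fun a _ => h4 a, map_smul, map_add, map_add, map_smul,
    map_smul, h1, h2, h3]
  module

/-! ### Products of many short evolutions -/

open Filter Topology Asymptotics in
/-- Two curves through `1` in a normed algebra with the same velocity at `0` have the same
product limit. -/
theorem tendsto_pow_sub_pow_of_hasDerivAt {𝔸 : Type*} [NormedRing 𝔸] [NormOneClass 𝔸]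
    [NormedSpace ℝ 𝔸] {a b : ℝ → 𝔸} {k : 𝔸} (ha : HasDerivAt a k 0) (hb : HasDerivAt b k 0)
    (ha0 : a 0 = 1) (hb0 : b 0 = 1) (t : ℝ) :
    Tendsto (fun m : ℕ => a (t / m) ^ m - b (t / m) ^ m) atTop (𝓝 0) := by
  -- The telescoping estimate. With `x - y = o(1/m)` and `M = exp(O(1/m))`, the factor `m` is
  -- compensated and `M ^ m` stays bounded.
  have hpow : ∀ (x y : 𝔸) (M : ℝ), 1 ≤ M → ‖x‖ ≤ M → ‖y‖ ≤ M → ∀ m : ℕ,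
      ‖x ^ m - y ^ m‖ ≤ m * ‖x - y‖ * M ^ m := by
    intro x y M hM hx hy m
    have hM0 : 0 ≤ M := zero_le_one.trans hM
    induction m with
    | zero => simp
    | succ m ih =>
      have hsplit : x ^ (m + 1) - y ^ (m + 1) = x ^ m * (x - y) + (x ^ m - y ^ m) * y := by
        rw [pow_succ, pow_succ]; noncomm_ring
      have h1 : ‖x ^ m * (x - y)‖ ≤ M ^ (m + 1) * ‖x - y‖ :=
        (norm_mul_le _ _).trans <| mul_le_mul_of_nonneg_right
          (((norm_pow_le x m).trans (pow_le_pow_left₀ (norm_nonneg _) hx m)).trans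
            (pow_le_pow_right₀ hM m.le_succ)) (norm_nonneg _)
      have h2 : ‖(x ^ m - y ^ m) * y‖ ≤ m * ‖x - y‖ * M ^ m * M :=
        (norm_mul_le _ _).trans (mul_le_mul ih hy (norm_nonneg _) (by positivity))
      rw [hsplit]
      refine (norm_add_le _ _).trans ((add_le_add h1 h2).trans (le_of_eq ?_))
      push_cast
      ring
  have hbound : ∀ {f : ℝ → 𝔸}, HasDerivAt f k 0 → f 0 = 1 →
      ∃ c : ℝ, 0 ≤ c ∧ ∀ᶠ s in 𝓝 (0 : ℝ), ‖f s‖ ≤ 1 + c * |s| := by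
    intro f hf hf0
    obtain ⟨c, hc0, hc⟩ := hf.hasFDerivAt.isBigO_sub.exists_nonneg
    refine ⟨c, hc0, hc.bound.mono fun s hs => ?_⟩
    rw [hf0, sub_zero, Real.norm_eq_abs] at hs
    calc ‖f s‖ = ‖1 + (f s - 1)‖ := by rw [add_sub_cancel]
      _ ≤ ‖(1 : 𝔸)‖ + ‖f s - 1‖ := norm_add_le _ _
      _ ≤ 1 + c * |s| := by rw [norm_one]; linarith
  obtain ⟨c, hc0, hc⟩ := hbound ha ha0
  obtain ⟨d, hd0, hd⟩ := hbound hb hb0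
  have hlim : Tendsto (fun m : ℕ => t / m) atTop (𝓝 0) :=
    tendsto_const_div_atTop_nhds_zero_nat t
  rw [← isLittleO_one_iff ℝ, isLittleO_iff]
  intro ε hε
  -- The summand `1` keeps the divisor positive when `t = 0`.
  set B : ℝ := |t| * Real.exp (max c d * |t|) + 1 with hB
  have hBpos : 0 < B := by positivity
  have hdiff := (hasDerivAt_iff_isLittleO.1 (ha.sub hb)).def (div_pos hε hBpos)
  filter_upwards [hlim.eventually hc, hlim.eventually hd, hlim.eventually hdiff,
    eventually_ge_atTop 1] with m h1 h2 h3 hm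
  have hm0 : (0 : ℝ) < m := by exact_mod_cast hm
  simp only [Pi.sub_apply, ha0, hb0, sub_self, smul_zero, sub_zero, Real.norm_eq_abs] at h3
  have hM : ∀ e ≤ max c d, 1 + e * |t / m| ≤ Real.exp (max c d * |t| / m) := by
    intro e he
    refine le_trans ?_ (Real.add_one_le_exp _)
    rw [abs_div, Nat.abs_cast, mul_div_assoc, add_comm]
    gcongr
  have hMone : 1 ≤ Real.exp (max c d * |t| / m) :=
    Real.one_le_exp (by have := hc0.trans (le_max_left c d); positivity)
  have hMpow : Real.exp (max c d * |t| / m) ^ m = Real.exp (max c d * |t|) := by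
    rw [← Real.exp_nat_mul]
    congr 1
    field_simp
  calc ‖a (t / m) ^ m - b (t / m) ^ m‖
      ≤ m * ‖a (t / m) - b (t / m)‖ * Real.exp (max c d * |t| / m) ^ m :=
        hpow _ _ _ hMone (h1.trans (hM c (le_max_left _ _))) (h2.trans (hM d (le_max_right _ _))) m
    _ ≤ m * (ε / B * |t / m|) * Real.exp (max c d * |t| / m) ^ m := by gcongr
    _ = ε / B * (|t| * Real.exp (max c d * |t|)) := by
        rw [hMpow, abs_div, Nat.abs_cast]
        field_simp
    _ ≤ ε / B * B := by gcongr; linarith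
    _ = ε * ‖(1 : ℝ)‖ := by rw [div_mul_cancel₀ _ hBpos.ne', norm_one, mul_one]

/-! ### The fast-control limit for an abstract retraction -/

section FastControl

open Filter Topology

variable {F : Type*} [NormedAddCommGroup F] [NormedSpace ℂ F]

theorem iterate_eq_pow_apply {W : Set F} {f : F → F} {T : F →L[ℂ] F}
    (hf : ∀ A ∈ W, f A ∈ W) (hT : ∀ A ∈ W, f A = T A) {A : F} (hA : A ∈ W) (m : ℕ) :
    f^[m] A = (T ^ m) A := by
  have h : f^[m] A ∈ W ∧ f^[m] A = (T ^ m) A := by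
    induction m with
    | zero => exact ⟨hA, rfl⟩
    | succ m ih =>
      rw [Function.iterate_succ_apply', pow_succ']
      exact ⟨hf _ ih.1, by rw [hT _ ih.1, ih.2]; rfl⟩
  exact h.2

variable [FiniteDimensional ℂ F]

theorem hasSum_exp_smul_apply (T : F →L[ℂ] F) (s : ℝ) (A : F) :
    HasSum (fun k : ℕ => ((s ^ k / k.factorial : ℝ) : ℂ) • T^[k] A)
      (NormedSpace.exp (s • T) A) := by
  have := FiniteDimensional.complete ℂ F
  have h := (NormedSpace.exp_series_hasSum_exp' (𝕂 := ℝ) (s • T)).mapL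
    ((ContinuousLinearMap.apply ℂ F A).restrictScalars ℝ)
  convert h using 2 with k
  · rw [smul_pow, smul_smul]
    simp only [ContinuousLinearMap.coe_restrictScalars', ContinuousLinearMap.apply_apply,
      smul_apply, FunLike.coe_pow_eq_iterate, Complex.coe_smul]
    rw [div_eq_inv_mul]
  · rfl

/-- The curve passes through `1` at time zero, whereas `S * exp (s T)` starts at `S`, which need not
be invertible. It is the form to which the product limit applies. -/
theorem hasDerivAt_one_add_mul_exp_sub_one_mul (S T P : F →L[ℂ] F) :
    HasDerivAt (fun s : ℝ => 1 + S * (NormedSpace.exp (s • T) - 1) * P) (S * T * P) 0 := by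
  have := FiniteDimensional.complete ℂ F
  have h := hasDerivAt_exp_smul_const (𝕂 := ℝ) T (0 : ℝ)
  rw [zero_smul, NormedSpace.exp_zero, one_mul] at h
  exact (((h.sub_const 1).const_mul S).mul_const P).const_add 1

/-- Let `Φ` map into `W` and fix `W` pointwise. Alternating the evolution `exp (s T)` with `Φ`
at an increasing rate yields on `W` the flow `D` of the generator `Φ ∘ T`. -/
theorem tendsto_iterate_fastControl [Nontrivial F] {W : Set F} {P Φ T K : F →ₗ[ℂ] F}
    (hPW : ∀ A, P A ∈ W) (hP : ∀ A ∈ W, P A = A) (hΦW : ∀ A, Φ A ∈ W) (hΦ : ∀ A ∈ W, Φ A = A)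
    (hgen : ∀ A ∈ W, Φ (T A) = K A) {D : ℝ → F → F}
    (hD : ∀ s A, HasSum (fun k : ℕ => ((s ^ k / k.factorial : ℝ) : ℂ) • K^[k] A) (D s A))
    (hDW : ∀ s, ∀ A ∈ W, D s A ∈ W) (hDm : ∀ s A (m : ℕ), (D s)^[m] A = D (m * s) A)
    (t : ℝ) {ρ : F} (hρ : ρ ∈ W) :
    Tendsto (fun m : ℕ => (fun A => Φ (∑' k : ℕ, (((t / m) ^ k / k.factorial : ℝ) : ℂ) •
      T^[k] A))^[m] ρ) atTop (𝓝 (D t ρ)) := by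
  set P' := P.toContinuousLinearMap with hP'
  set S := Φ.toContinuousLinearMap with hS
  set T' := T.toContinuousLinearMap with hT'
  set K' := K.toContinuousLinearMap with hK'
  -- On `W`, where `P` and `Φ` are the identity, this agrees with evolution followed by `Φ`;
  -- likewise `b` agrees with the flow `D`. Both have velocity `K * P` at zero.
  set a : ℝ → F →L[ℂ] F := fun s => 1 + S * (NormedSpace.exp (s • T') - 1) * P' with ha
  set b : ℝ → F →L[ℂ] F := fun s => 1 + 1 * (NormedSpace.exp (s • K') - 1) * P' with hb
  have hda : HasDerivAt a (1 * K' * P') 0 := by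
    convert hasDerivAt_one_add_mul_exp_sub_one_mul S T' P' using 1
    ext1 A
    exact (hgen _ (hPW A)).symm
  have hdb : HasDerivAt b (1 * K' * P') 0 := hasDerivAt_one_add_mul_exp_sub_one_mul 1 K' P'
  have hlim := tendsto_pow_sub_pow_of_hasDerivAt hda hdb
    (by simp [ha]) (by simp [hb]) t
  have haW : ∀ s : ℝ, ∀ A ∈ W,
      Φ (∑' k : ℕ, ((s ^ k / k.factorial : ℝ) : ℂ) • T^[k] A) = a s A := by
    intro s A hA
    change _ = A + S (NormedSpace.exp (s • T') (P A) - P A)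
    rw [hP A hA, map_sub]
    change _ = A + (S _ - Φ A)
    rw [hΦ A hA, add_sub_cancel, ← (hasSum_exp_smul_apply T' s A).tsum_eq]
    rfl
  have hbW : ∀ s : ℝ, ∀ A ∈ W, D s A = b s A := by
    intro s A hA
    change _ = A + (NormedSpace.exp (s • K') (P A) - P A)
    rw [hP A hA, add_sub_cancel]
    exact (hD s A).unique (hasSum_exp_smul_apply K' s A)
  -- The comparison product is exact, as `D` is a flow; `m = 0` is excluded because of the division.
  have hrot : ∀ᶠ m : ℕ in atTop, (b (t / m) ^ m) ρ = D t ρ := by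
    filter_upwards [eventually_ge_atTop 1] with m hm
    have hm0 : (m : ℝ) ≠ 0 := by positivity
    rw [← iterate_eq_pow_apply (hDW (t / m)) (hbW (t / m)) hρ m, hDm, mul_div_cancel₀ _ hm0]
  have h1 : Tendsto (fun m : ℕ => (a (t / m) ^ m - b (t / m) ^ m) ρ) atTop (𝓝 0) := by
    have := ((ContinuousLinearMap.apply ℂ F ρ).continuous.tendsto 0).comp hlim
    rwa [map_zero] at this
  have h2 := h1.add_const (D t ρ)
  rw [zero_add] at h2
  refine h2.congr' ?_
  filter_upwards [hrot] with m hm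
  rw [iterate_eq_pow_apply (fun A _ => hΦW _) (haW (t / m)) hρ m, sub_apply,
    hm, sub_add_cancel]

end FastControl

/-! ### The output state as a diagonal rotation of the initial state -/

section OutputState

variable {n : ℕ}

/-- The generator of the master equation as a linear map. -/
def lindbladianLinear (E : Environment n) (ω : ℝ) : Op n →ₗ[ℂ] Op n where
  toFun := lindbladian E ω
  map_add' A B := by
    simp only [lindbladian, mul_add, add_mul, smul_add, smul_sub, Finset.sum_add_distrib,
      Finset.sum_sub_distrib]
    abel
  map_smul' c A := by
    simp only [lindbladian, mul_smul_comm, smul_mul_assoc, RingHom.id_apply, smul_add,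
      Finset.smul_sum, smul_sub, smul_comm c]

/-- The operator `U A U†` with the diagonal unitary `U = exp (-i θ q)`. -/
def rotate (q : Basis n → ℝ) (θ : ℝ) (A : Op n) : Op n :=
  Matrix.of fun x y => Complex.exp (-Complex.I * θ * (q x - q y)) * A x y

theorem rotate_rotate (q : Basis n → ℝ) (θ θ' : ℝ) (A : Op n) :
    rotate q θ (rotate q θ' A) = rotate q (θ + θ') A := by
  ext x y
  simp only [rotate, Matrix.of_apply]
  rw [← mul_assoc, ← Complex.exp_add]
  push_cast
  ring_nf

theorem rotate_zero (q : Basis n → ℝ) (A : Op n) : rotate q 0 A = A := by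
  ext x y
  simp [rotate]

theorem rotate_iterate (q : Basis n → ℝ) (θ : ℝ) (A : Op n) (m : ℕ) :
    (rotate q θ)^[m] A = rotate q (m * θ) A := by
  induction m with
  | zero => simp [rotate_zero]
  | succ m ih =>
    rw [Function.iterate_succ_apply', ih, rotate_rotate]
    push_cast
    ring_nf

/-- The generator of `rotate`. -/
def rotateGenerator (q : Basis n → ℝ) (ω : ℝ) : Op n →ₗ[ℂ] Op n where
  toFun A := Matrix.of fun x y => (-Complex.I * ω * (q x - q y)) * A x y
  map_add' A B := by ext x y; simp [mul_add]
  map_smul' c A := by ext x y; simp; ring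

theorem hasSum_rotateGenerator_iterate (q : Basis n → ℝ) (ω s : ℝ) (A : Op n) :
    HasSum (fun k : ℕ => ((s ^ k / k.factorial : ℝ) : ℂ) • (rotateGenerator q ω)^[k] A)
      (rotate q (ω * s) A) := by
  refine Pi.hasSum.2 fun x => Pi.hasSum.2 fun y => ?_
  have hiter : ∀ k : ℕ, (rotateGenerator q ω)^[k] A x y =
      (-Complex.I * ω * (q x - q y)) ^ k * A x y := by
    intro k
    induction k with
    | zero => simp
    | succ k ih =>
      rw [Function.iterate_succ_apply']
      change (-Complex.I * ω * (q x - q y)) * _ = _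
      rw [ih]
      ring
  have h := (NormedSpace.exp_series_hasSum_exp' (𝕂 := ℂ)
    (-Complex.I * (ω * s : ℝ) * (q x - q y))).mul_right (A x y)
  rw [← Complex.exp_eq_exp_ℂ] at h
  refine h.congr_fun fun k => ?_
  rw [Matrix.smul_apply, hiter]
  push_cast
  simp only [smul_eq_mul, mul_pow]
  field_simp

theorem rotate_supportsOp {C : StabilizerCode n} (θ : ℝ) {A : Op n} (hA : C.SupportsOp A) :
    C.SupportsOp (rotate C.phase θ A) := by
  -- Commuting with the diagonal `logicalG` means that the projector connects only basis labels of
  -- equal phase, so the rotation leaves it invariant.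
  have hcomm : ∀ x y, C.projector x y ≠ 0 → C.phase x = C.phase y := by
    intro x y hxy
    have h := congrFun₂ C.commute_logicalG_projector.eq x y
    rw [StabilizerCode.logicalG, Matrix.diagonal_mul, Matrix.mul_diagonal, mul_comm] at h
    exact_mod_cast mul_left_cancel₀ hxy h
  rw [C.supportsOp_iff]
  constructor
  · ext x y
    conv_rhs => rw [rotate, Matrix.of_apply, ← hA.projector_mul]
    simp only [Matrix.mul_apply, Finset.mul_sum, rotate, Matrix.of_apply]
    refine Finset.sum_congr rfl fun z _ => ?_
    by_cases h : C.projector x z = 0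
    · simp [h]
    · rw [hcomm x z h]; ring
  · ext x y
    conv_rhs => rw [rotate, Matrix.of_apply, ← hA.mul_projector]
    simp only [Matrix.mul_apply, Finset.mul_sum, rotate, Matrix.of_apply]
    refine Finset.sum_congr rfl fun z _ => ?_
    by_cases h : C.projector z y = 0
    · simp [h]
    · rw [hcomm z y h]; ring

attribute [local instance] Matrix.normedAddCommGroup Matrix.normedSpace in
/-- In the fast-control limit the output state evolves unitarily under the logical terms of the
Hamiltonian. -/
theorem IsRecovery.isOutputState {C : StabilizerCode n} {R : Op n → Op n}
    (hC : ∀ P, C.IsLogical P → 2 < weight P) (hR : IsRecovery C R) (i : Fin n)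
    (htr : C.projector.trace ≠ 0) (E : Environment n) (ω t : ℝ) {ρ₀ : Op n}
    (hρ : C.SupportsOp ρ₀) : IsOutputState E R ω t ρ₀ (rotate C.phase (ω * t) ρ₀) := by
  obtain ⟨Φ, rfl⟩ := hR.1.exists_linearMap
  refine tendsto_iterate_fastControl (W := {A | C.SupportsOp A})
    (P := LinearMap.mulRight ℂ C.projector ∘ₗ LinearMap.mulLeft ℂ C.projector) (Φ := Φ)
    (T := lindbladianLinear E ω) (K := rotateGenerator C.phase ω)
    (D := fun s => rotate C.phase (ω * s))
    (fun A => C.supportsOp_projector_mul_mul A) (fun A hA => ?_) hR.2.1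
    (fun A hA => hR.apply_of_supportsOp i htr hA) (fun A hA => ?_)
    (hasSum_rotateGenerator_iterate C.phase ω) (fun s A hA => rotate_supportsOp _ hA)
    (fun s A m => ?_) t hρ
  · change C.projector * A * C.projector = A
    rw [StabilizerCode.SupportsOp.projector_mul hA, StabilizerCode.SupportsOp.mul_projector hA]
  · refine (hR.apply_lindbladian hC i htr E ω hA).trans ?_
    ext x y
    change _ = (-Complex.I * ω * (C.phase x - C.phase y)) * A x y
    rw [Matrix.smul_apply, Matrix.sub_apply, StabilizerCode.logicalG, Matrix.diagonal_mul,
      Matrix.mul_diagonal, smul_eq_mul]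
    ring
  · rw [rotate_iterate]
    ring_nf

end OutputState

/-! ### Quantum Fisher information of the output state -/

theorem rotate_mul (q : Basis n → ℝ) (θ : ℝ) (A B : Op n) :
    rotate q θ (A * B) = rotate q θ A * rotate q θ B := by
  ext x y
  simp only [rotate, Matrix.of_apply, Matrix.mul_apply, Finset.mul_sum]
  refine Finset.sum_congr rfl fun z _ => ?_
  rw [mul_mul_mul_comm, ← Complex.exp_add]
  ring_nf

theorem rotate_conjTranspose (q : Basis n → ℝ) (θ : ℝ) (A : Op n) :
    (rotate q θ A)ᴴ = rotate q θ Aᴴ := by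
  ext x y
  simp only [rotate, Matrix.of_apply, Matrix.conjTranspose_apply, star_mul', Complex.star_def,
    ← Complex.exp_conj, map_mul, map_sub, map_neg, Complex.conj_I, Complex.conj_ofReal]
  ring_nf

theorem rotate_apply_self (q : Basis n → ℝ) (θ : ℝ) (A : Op n) (x : Basis n) :
    rotate q θ A x x = A x x := by
  simp [rotate]

theorem trace_rotate (q : Basis n → ℝ) (θ : ℝ) (A : Op n) : (rotate q θ A).trace = A.trace := by
  simp only [Matrix.trace, Matrix.diag_apply, rotate_apply_self]

theorem rotate_posSemidef (q : Basis n → ℝ) (θ : ℝ) {A : Op n} (hA : A.PosSemidef) :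
    (rotate q θ A).PosSemidef := by
  convert hA.mul_mul_conjTranspose_same
    (Matrix.diagonal fun x => Complex.exp (-Complex.I * θ * q x)) using 1
  ext x y
  rw [Matrix.diagonal_conjTranspose, Matrix.mul_diagonal, Matrix.diagonal_mul, rotate,
    Matrix.of_apply, mul_right_comm _ (A x y), Pi.star_apply, Complex.star_def, ← Complex.exp_conj,
    ← Complex.exp_add]
  simp only [map_mul, map_neg, Complex.conj_I, Complex.conj_ofReal]
  ring_nf

theorem hasDerivAt_rotate (q : Basis n → ℝ) (ω t : ℝ) (A : Op n) (x y : Basis n) :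
    HasDerivAt (fun w : ℝ => rotate q (w * t) A x y)
      ((-Complex.I * t * (q x - q y)) * rotate q (ω * t) A x y) ω := by
  have h0 : HasDerivAt (fun w : ℝ => (w : ℂ)) 1 ω := Complex.ofRealCLM.hasDerivAt
  have h1 : HasDerivAt (fun w : ℝ => -Complex.I * (w * t : ℝ) * (q x - q y))
      (-Complex.I * t * (q x - q y)) ω := by
    have := (h0.const_mul (-Complex.I * t * (q x - q y)))
    rw [mul_one] at this
    refine this.congr_of_eventuallyEq (Filter.Eventually.of_forall fun w => ?_)
    push_cast
    ring
  refine (h1.cexp.mul_const (A x y)).congr_deriv ?_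
  rw [rotate, Matrix.of_apply]
  ring

theorem commutator_diagonal_apply (q : Basis n → ℝ) (c : ℂ) (A : Op n) (x y : Basis n) :
    (c • (Matrix.diagonal (fun x => (q x : ℂ)) * A - A * Matrix.diagonal fun x => (q x : ℂ))) x y =
      c * (q x - q y) * A x y := by
  rw [Matrix.smul_apply, Matrix.sub_apply, Matrix.diagonal_mul, Matrix.mul_diagonal, smul_eq_mul]
  ring

theorem rotate_smul_commutator (q : Basis n → ℝ) (θ : ℝ) (c : ℂ) (A : Op n) :
    rotate q θ (c • (Matrix.diagonal (fun x => (q x : ℂ)) * A -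
      A * Matrix.diagonal fun x => (q x : ℂ))) =
    c • (Matrix.diagonal (fun x => (q x : ℂ)) * rotate q θ A -
      rotate q θ A * Matrix.diagonal fun x => (q x : ℂ)) := by
  ext x y
  rw [commutator_diagonal_apply, rotate, Matrix.of_apply, commutator_diagonal_apply, rotate,
    Matrix.of_apply]
  ring

theorem rotate_add (q : Basis n → ℝ) (θ : ℝ) (A B : Op n) :
    rotate q θ (A + B) = rotate q θ A + rotate q θ B := by
  ext x y
  simp [rotate, mul_add]

theorem rotate_smul (q : Basis n → ℝ) (θ : ℝ) (c : ℂ) (A : Op n) :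
    rotate q θ (c • A) = c • rotate q θ A := by
  ext x y
  simp [rotate]
  ring

/-- A symmetric logarithmic derivative at the initial state, for the derivative `-i t [Q, ρ]`,
rotates along with the state and yields the same quantum Fisher information. -/
theorem isQFI_rotate (q : Basis n → ℝ) (ω t : ℝ) {ρ L : Op n} (hL : L.IsHermitian)
    (hsld : (1 / 2 : ℂ) • (L * ρ + ρ * L) = (-Complex.I * t) •
      (Matrix.diagonal (fun x => (q x : ℂ)) * ρ - ρ * Matrix.diagonal fun x => (q x : ℂ)))
    {F : ℝ} (hF : (F : ℂ) = (ρ * (L * L)).trace) :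
    IsQFI (fun w => rotate q (w * t) ρ) ω F := by
  refine ⟨rotate q (ω * t) L, ?_, fun x y => ?_, ?_⟩
  · rw [Matrix.IsHermitian, rotate_conjTranspose, hL.eq]
  · rw [← rotate_mul, ← rotate_mul, ← rotate_add, ← rotate_smul, hsld, rotate_smul_commutator,
      commutator_diagonal_apply]
    exact hasDerivAt_rotate q ω t ρ x y
  · rw [← rotate_mul, ← rotate_mul, trace_rotate, hF]

theorem IsQFI.exists_sld_of_rotate {q : Basis n → ℝ} {ω t : ℝ} {ρ : Op n} {F : ℝ}
    (h : IsQFI (fun w => rotate q (w * t) ρ) ω F) :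
    ∃ L : Op n, L.IsHermitian ∧
      (1 / 2 : ℂ) • (L * rotate q (ω * t) ρ + rotate q (ω * t) ρ * L) = (-Complex.I * t) •
        (Matrix.diagonal (fun x => (q x : ℂ)) * rotate q (ω * t) ρ -
          rotate q (ω * t) ρ * Matrix.diagonal fun x => (q x : ℂ)) ∧
      (F : ℂ) = (rotate q (ω * t) ρ * (L * L)).trace := by
  obtain ⟨L, hL, hder, hF⟩ := h
  refine ⟨L, hL, ?_, hF⟩
  ext x y
  rw [commutator_diagonal_apply]
  exact (hder x y).unique (hasDerivAt_rotate q ω t ρ x y)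

/-- For unitary families, the quantum Fisher information is at most four times the second moment
of the generator. -/
theorem le_four_mul_trace_of_sld {ρ L Q : Op n} (hρ : ρ.PosSemidef) (hL : L.IsHermitian)
    (hQ : Q.IsHermitian) {t F : ℝ}
    (hsld : (1 / 2 : ℂ) • (L * ρ + ρ * L) = (-Complex.I * t) • (Q * ρ - ρ * Q))
    (hF : (F : ℂ) = (ρ * (L * L)).trace) : (F : ℂ) ≤ 4 * t ^ 2 * (ρ * (Q * Q)).trace := by
  -- The defining equation of `L`, multiplied by `L` and traced, expresses `F` through the cross
  -- terms of `L` and `Q`.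
  have hcross : (F : ℂ) =
      -Complex.I * t * ((ρ * (L * Q)).trace - (ρ * (Q * L)).trace) := by
    have h := congrArg (fun A => (A * L).trace) hsld
    simp only [smul_mul_assoc, add_mul, sub_mul, Matrix.trace_smul, Matrix.trace_add,
      Matrix.trace_sub, smul_eq_mul] at h
    rw [mul_assoc, Matrix.trace_mul_comm L, mul_assoc ρ L L, mul_assoc ρ, mul_assoc Q,
      Matrix.trace_mul_comm Q, mul_assoc, ← hF, mul_assoc ρ] at h
    linear_combination h
  -- With the coefficient `2it` the cross terms contribute `-2F`, which leaves `4t² tr(ρQ²) - F ≥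
  -- 0`.
  have hpos := (hρ.mul_mul_conjTranspose_same (L + (2 * Complex.I * t) • Q)).trace_nonneg
  have hadj : (L + (2 * Complex.I * t) • Q)ᴴ = L - (2 * Complex.I * t) • Q := by
    rw [Matrix.conjTranspose_add, Matrix.conjTranspose_smul, hL.eq, hQ.eq, sub_eq_add_neg,
      ← neg_smul]
    congr 2
    simp
  have hexp : ((L + (2 * Complex.I * t) • Q) * ρ * (L + (2 * Complex.I * t) • Q)ᴴ).trace =
      4 * t ^ 2 * (ρ * (Q * Q)).trace - F := by
    rw [mul_assoc, Matrix.trace_mul_comm, mul_assoc, hadj]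
    simp only [sub_mul, mul_add, mul_sub, smul_mul_assoc, mul_smul_comm,
      Matrix.trace_add, Matrix.trace_sub, Matrix.trace_smul, smul_eq_mul]
    linear_combination (-1 : ℂ) * hF + (2 : ℂ) * hcross -
      4 * t ^ 2 * (ρ * (Q * Q)).trace * Complex.I_sq
  rw [hexp] at hpos
  exact sub_nonneg.1 hpos

theorem trace_mul_diagonal_sq_le {ρ : Op n} (hρ : ρ.PosSemidef) (htr : ρ.trace = 1)
    {q : Basis n → ℝ} {l : ℝ} (hq : ∀ x, |q x| ≤ l) :
    (ρ * (Matrix.diagonal (fun x => (q x : ℂ)) * Matrix.diagonal fun x => (q x : ℂ))).trace ≤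
      (l : ℂ) ^ 2 := by
  rw [Matrix.diagonal_mul_diagonal, ← one_mul ((l : ℂ) ^ 2), ← htr]
  simp only [Matrix.trace, Matrix.diag_apply, Matrix.mul_diagonal, Finset.sum_mul]
  refine Finset.sum_le_sum fun x _ => mul_le_mul_of_nonneg_left ?_ hρ.diag_nonneg
  have : q x ^ 2 ≤ l ^ 2 := sq_le_sq.2 ((hq x).trans (le_abs_self l))
  rw [← sq]
  exact_mod_cast this

/-! ### Qubit states -/

/-- Cayley-Hamilton in dimension two. -/
theorem fin_two_mul_self (M : Matrix (Fin 2) (Fin 2) ℂ) :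
    M * M = M.trace • M - M.det • (1 : Matrix (Fin 2) (Fin 2) ℂ) := by
  rw [Matrix.eta_fin_two M]
  ext i j
  fin_cases i <;> fin_cases j <;> simp [Matrix.trace, Matrix.det_fin_two] <;> ring

theorem exists_mul_self_eq_trace_smul_sub {V : Type*} [AddCommGroup V] [Module ℂ V]
    (hV : Module.finrank ℂ V = 2) (f : V →ₗ[ℂ] V) :
    ∃ d : ℂ, f * f = LinearMap.trace ℂ V f • f - d • (1 : V →ₗ[ℂ] V) := by
  have : Module.Finite ℂ V := Module.finite_of_finrank_pos (by omega)
  let b := Module.finBasisOfFinrankEq ℂ V hV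
  refine ⟨(LinearMap.toMatrix b b f).det, (LinearMap.toMatrix b b).injective ?_⟩
  rw [LinearMap.toMatrix_mul, fin_two_mul_self, map_sub, map_smul, map_smul,
    LinearMap.toMatrix_one, LinearMap.trace_eq_matrix_trace ℂ b]

/-- Cayley-Hamilton for the restriction to the code space, whose trace equals that of `ρ` because
the range of `ρ` lies there. It covers mixed states; a pure state corresponds to `d = 0`. -/
theorem StabilizerCode.SupportsOp.exists_mul_self_eq {C : StabilizerCode n}
    (hdim : Module.finrank ℂ C.codeSpace = 2) {ρ : Op n} (hρ : C.SupportsOp ρ)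
    (htr : ρ.trace = 1) : ∃ d : ℂ, ρ * ρ = ρ - d • C.projector := by
  have hmem : ∀ v, Matrix.toLin' ρ v ∈ C.codeSpace := fun v => by simpa using hρ.1 v
  have htrf := LinearMap.trace_restrict_eq_of_forall_mem C.codeSpace (Matrix.toLin' ρ) hmem
  rw [Matrix.trace_toLin'_eq, htr] at htrf
  obtain ⟨d, hd⟩ := exists_mul_self_eq_trace_smul_sub hdim
    ((Matrix.toLin' ρ).restrict fun v _ => hmem v)
  rw [htrf, one_smul] at hd
  refine ⟨d, ?_⟩
  suffices h : ρ * ρ * C.projector = (ρ - d • C.projector) * C.projector by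
    rwa [mul_assoc, hρ.mul_projector, sub_mul, hρ.mul_projector, smul_mul_assoc,
      C.projector_mul_self] at h
  refine Matrix.ext_of_mulVec_single fun x => ?_
  have h := congrArg Subtype.val (LinearMap.congr_fun hd
    ⟨C.projector *ᵥ Pi.single x 1, C.projector_mulVec_mem _⟩)
  simp only [Module.End.mul_apply, LinearMap.sub_apply, LinearMap.smul_apply, Module.End.one_apply,
    Submodule.coe_sub, Submodule.coe_smul, LinearMap.coe_restrict_apply, Matrix.toLin'_apply,
    Matrix.mulVec_mulVec] at h
  rw [mul_assoc, ← Matrix.mulVec_mulVec, ← Matrix.mulVec_mulVec, sub_mul, smul_mul_assoc,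
    C.projector_mul_self, Matrix.sub_mulVec, Matrix.smul_mulVec, ← h]
  simp only [Matrix.mulVec_mulVec]

/-- The derivative of a unitary family of states of a logical qubit is half a symmetric
logarithmic derivative. -/
theorem sld_of_mul_self_eq {ρ Q P : Op n} {d c : ℂ} (hρ : ρ * ρ = ρ - d • P) (hQ : Commute Q P) :
    (1 / 2 : ℂ) • ((2 * c) • (Q * ρ - ρ * Q) * ρ + ρ * (2 * c) • (Q * ρ - ρ * Q)) =
      c • (Q * ρ - ρ * Q) := by
  have h1 : Q * ρ * ρ = Q * ρ - d • (Q * P) := by rw [mul_assoc, hρ, mul_sub, mul_smul_comm]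
  have h2 : ρ * (ρ * Q) = ρ * Q - d • (Q * P) := by
    rw [← mul_assoc, hρ, sub_mul, smul_mul_assoc, hQ.eq]
  rw [smul_mul_assoc, mul_smul_comm, sub_mul, mul_sub, h1, h2, mul_assoc ρ Q ρ]
  module

/-! ### The optimal state -/

theorem vecMulVec_mul_mul_vecMulVec {ι : Type*} [Fintype ι] (a b c d : ι → ℂ)
    (M : Matrix ι ι ℂ) : Matrix.vecMulVec a b * M * Matrix.vecMulVec c d =
      (b ⬝ᵥ M *ᵥ c) • Matrix.vecMulVec a d := by
  rw [mul_assoc, Matrix.mul_vecMulVec, Matrix.vecMulVec_mul_vecMulVec, Matrix.vecMulVec_smul]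

namespace StabilizerCode

variable (C : StabilizerCode n)

/-- A string containing `X` or `Y` has zero diagonal, and a positive `Z`-type string has entry 1 at
`|0⋯0⟩`. No cancellation can occur, and the identity contributes 1. -/
theorem projector_zero_zero_ne_zero (hpos : C.PositiveZType) : C.projector 0 0 ≠ 0 := by
  have hs : ∀ s ∈ C.group, (s : Op n) 0 0 = 0 ∨ (s : Op n) 0 0 = 1 := by
    intro s hs
    obtain ⟨c, P, -, h⟩ := C.exists_eq_smul_pauliOp hs
    rw [h]
    by_cases hZ : ∀ q, P q = Pauli.I ∨ P q = Pauli.Z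
    · right
      rw [hpos c P hZ ⟨s, hs, h⟩, one_smul, pauliOp_eq_diagonal hZ, Matrix.diagonal_apply_eq,
        zSign_zero, Complex.ofReal_one]
    · left
      push Not at hZ
      obtain ⟨q, hI, hZ⟩ := hZ
      rw [Matrix.smul_apply, pauliOp, tensor_apply, Finset.prod_eq_zero (Finset.mem_univ q),
        smul_zero]
      cases h : P q <;> first | exact absurd h hI | exact absurd h hZ | simp [Pauli.mat]
  rw [projector, Matrix.smul_apply, Matrix.sum_apply]
  refine smul_ne_zero (inv_ne_zero C.card_group_ne_zero) fun h0 => ?_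
  have hnonneg : ∀ s : C.group, 0 ≤ ((s : (Op n)ˣ) : Op n) 0 0 := fun s => by
    rcases hs s s.2 with h | h <;> rw [h]
    exact zero_le_one
  have := (Finset.sum_eq_zero_iff_of_nonneg fun s _ => hnonneg s).1 h0 1 (Finset.mem_univ _)
  simp at this

/-- If the `Z`-type stabilizers are positive, the projection of `|0⋯0⟩` onto the code space is a
joint eigenvector of all the logical `Z`-type operators. -/
theorem exists_unit_eq_plus (hpos : C.PositiveZType) :
    ∃ a : Ket n, star a ⬝ᵥ a = 1 ∧ C.projector *ᵥ a = a ∧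
      ∀ p ∈ C.logicalTriples, pauliOp (zzz p) *ᵥ a = a := by
  set v : Ket n := C.projector *ᵥ Pi.single 0 1 with hv
  have hv0 : v ≠ 0 := fun h => C.projector_zero_zero_ne_zero hpos <| by
    have := congrFun h 0
    rwa [hv, Matrix.mulVec_single_one] at this
  obtain ⟨c, -, hc⟩ := exists_smul_star_dotProduct_self hv0
  refine ⟨c • v, hc, ?_, fun p hp => ?_⟩
  · rw [Matrix.mulVec_smul, C.mem_codeSpace_iff.1 (C.projector_mulVec_mem _)]
  · rw [Matrix.mulVec_smul, hv, Matrix.mulVec_mulVec,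
      (C.isLogical_of_mem_logicalTriples hp).commute_projector.eq, ← Matrix.mulVec_mulVec,
      pauliOp_eq_diagonal (zzz_eq_I_or_Z p)]
    congr 2
    ext x
    rw [Matrix.mulVec_diagonal]
    by_cases hx : x = 0
    · subst hx; simp [zSign_zero]
    · simp [hx]

/-- A logical operator is a traceless involution on the two-dimensional code space, so its `+1`
eigenspace is the line through `a`. The right-hand side does not involve `P`, so all logical
operators fixing `a` agree on the code space. -/
theorem projector_mul_pauliOp_eq (htr : C.projector.trace = 2) {P : Fin n → Pauli}
    (hP : C.IsLogical P) {a : Ket n} (ha : star a ⬝ᵥ a = 1) (hCa : C.projector *ᵥ a = a)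
    (hPa : pauliOp P *ᵥ a = a) :
    C.projector * pauliOp P = (2 : ℂ) • Matrix.vecMulVec a (star a) - C.projector := by
  set A := Matrix.vecMulVec a (star a) with hA
  have hAA : A * A = A := by rw [hA, Matrix.vecMulVec_mul_vecMulVec, ha, one_smul]
  have hAh : Aᴴ = A := by rw [hA, Matrix.conjTranspose_vecMulVec, star_star]
  have hAtr : A.trace = 1 := by rw [hA, Matrix.trace_vecMulVec, dotProduct_comm, ha]
  set E := (1 / 2 : ℂ) • (C.projector + C.projector * pauliOp P) with hE
  have hEh : Eᴴ = E := by
    rw [hE, Matrix.conjTranspose_smul, Matrix.conjTranspose_add, Matrix.conjTranspose_mul,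
      C.projector_isHermitian, pauliOp_isHermitian, hP.commute_projector.eq]
    simp
  have hEE : E * E = E := by
    have h1 : C.projector * pauliOp P * C.projector = C.projector * pauliOp P := by
      rw [mul_assoc, hP.commute_projector.eq, ← mul_assoc, C.projector_mul_self]
    have h2 : C.projector * (C.projector * pauliOp P) = C.projector * pauliOp P := by
      rw [← mul_assoc, C.projector_mul_self]
    have h3 : C.projector * pauliOp P * (C.projector * pauliOp P) = C.projector := by
      rw [← mul_assoc, h1, mul_assoc, pauliOp_mul_self, mul_one]
    rw [hE, smul_mul_smul_comm, add_mul, mul_add, mul_add, C.projector_mul_self, h1, h2, h3]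
    module
  have hEA : E * A = A := by
    rw [hE, hA, Matrix.mul_vecMulVec, Matrix.smul_mulVec, Matrix.add_mulVec,
      ← Matrix.mulVec_mulVec, hPa, hCa]
    congr 1
    module
  have hAE : A * E = A := by
    rw [← hEh, ← hAh, ← Matrix.conjTranspose_mul, hEA]
  -- `E` projects onto the `+1` eigenspace and dominates the rank-one projector `A`; both have trace
  -- 1, so the squared norm of the difference is zero.
  have hD : E - A = 0 := by
    rw [← Matrix.trace_conjTranspose_mul_self_eq_zero_iff, Matrix.conjTranspose_sub, hEh, hAh,
      sub_mul, mul_sub, mul_sub, hEE, hEA, hAE, hAA, sub_self, sub_zero, Matrix.trace_sub, hAtr,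
      hE, Matrix.trace_smul, Matrix.trace_add, htr, hP.trace_projector_mul]
    norm_num
  rw [← sub_eq_zero.1 hD, hE, smul_smul]
  norm_num

theorem exists_unit_orthogonal (htr : C.projector.trace = 2) {a : Ket n} (ha : star a ⬝ᵥ a = 1)
    (hCa : C.projector *ᵥ a = a) :
    ∃ b : Ket n, star b ⬝ᵥ b = 1 ∧ C.projector *ᵥ b = b ∧ star a ⬝ᵥ b = 0 := by
  set B := C.projector - Matrix.vecMulVec a (star a) with hB
  have hB0 : B ≠ 0 := fun h => by
    have h1 := congrArg Matrix.trace h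
    rw [hB, Matrix.trace_sub, htr, Matrix.trace_vecMulVec, dotProduct_comm, ha,
      Matrix.trace_zero] at h1
    norm_num at h1
  obtain ⟨x, hx⟩ : ∃ x, B *ᵥ Pi.single x 1 ≠ 0 := by
    by_contra! hcon
    exact hB0 (Matrix.ext_of_mulVec_single fun x => by rw [hcon x, Matrix.zero_mulVec])
  have hCA : C.projector * Matrix.vecMulVec a (star a) = Matrix.vecMulVec a (star a) := by
    rw [Matrix.mul_vecMulVec, hCa]
  have haC : star a ᵥ* C.projector = star a := by
    rw [← C.projector_isHermitian, ← Matrix.star_mulVec, hCa]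
  have haB : star a ᵥ* B = 0 := by
    rw [hB, Matrix.vecMul_sub, haC, Matrix.vecMul_vecMulVec, ha, one_smul, sub_self]
  obtain ⟨c, -, hc⟩ := exists_smul_star_dotProduct_self hx
  refine ⟨_, hc, ?_, ?_⟩
  · rw [Matrix.mulVec_smul, Matrix.mulVec_mulVec, hB, mul_sub, C.projector_mul_self, hCA]
  · rw [dotProduct_smul, Matrix.dotProduct_mulVec, haB, zero_dotProduct, smul_zero]

/-- If the `Z`-type stabilizers are positive, some pure code state has vanishing mean and maximal
second moment of the logical part of `G`. -/
theorem exists_optimal_state (htr : C.projector.trace = 2) (hpos : C.PositiveZType) :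
    ∃ ψ ∈ C.codeSpace, star ψ ⬝ᵥ ψ = 1 ∧ star ψ ⬝ᵥ C.logicalG *ᵥ ψ = 0 ∧
      C.logicalG *ᵥ C.logicalG *ᵥ ψ = ((numLogical C : ℂ) ^ 2) • ψ := by
  obtain ⟨a, ha, hCa, hPa⟩ := C.exists_unit_eq_plus hpos
  obtain ⟨b, hb, hCb, hab⟩ := C.exists_unit_orthogonal htr ha hCa
  have hba : star b ⬝ᵥ a = 0 := by
    rw [← star_star (star b ⬝ᵥ a), Matrix.star_dotProduct, star_star, hab,
      star_zero]
  have hPb : ∀ p ∈ C.logicalTriples, pauliOp (zzz p) *ᵥ b = -b := by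
    intro p hp
    have hlog := C.isLogical_of_mem_logicalTriples hp
    rw [← hCb, Matrix.mulVec_mulVec, hlog.commute_projector.eq,
      C.projector_mul_pauliOp_eq htr hlog ha hCa (hPa p hp), Matrix.sub_mulVec,
      Matrix.smul_mulVec, Matrix.vecMulVec_mulVec, hab, hCb]
    simp
  have hQa : C.logicalG *ᵥ a = (numLogical C : ℂ) • a := by
    rw [logicalG_eq_sum, Matrix.sum_mulVec, Finset.sum_congr rfl hPa, Finset.sum_const,
      card_logicalTriples, Nat.cast_smul_eq_nsmul]
  have hQb : C.logicalG *ᵥ b = -((numLogical C : ℂ) • b) := by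
    rw [logicalG_eq_sum, Matrix.sum_mulVec, Finset.sum_congr rfl hPb, Finset.sum_const,
      card_logicalTriples, Nat.cast_smul_eq_nsmul, smul_neg]
  have hr : ((√2)⁻¹ : ℂ) * ((√2)⁻¹ : ℂ) = 1 / 2 := by
    rw [← mul_inv, ← Complex.ofReal_mul, Real.mul_self_sqrt zero_le_two]
    norm_num
  -- Equal weight on the eigenvalues `ℓ` and `-ℓ` gives mean zero and keeps the second moment `ℓ²`.
  refine ⟨((√2)⁻¹ : ℂ) • (a + b), ?_, ?_, ?_, ?_⟩
  · rw [mem_codeSpace_iff, Matrix.mulVec_smul, Matrix.mulVec_add, hCa, hCb]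
  · rw [star_smul, smul_dotProduct, dotProduct_smul, smul_smul]
    simp only [star_add, add_dotProduct, dotProduct_add, ha, hb, hab, hba, star_inv₀,
      Complex.star_def, Complex.conj_ofReal, hr]
    norm_num
  · rw [Matrix.mulVec_smul, Matrix.mulVec_add, hQa, hQb, star_smul, smul_dotProduct,
      dotProduct_smul]
    simp [add_dotProduct, dotProduct_add, ha, hb, hab, hba]
  · simp only [Matrix.mulVec_smul, Matrix.mulVec_add, Matrix.mulVec_neg, hQa, hQb]
    module

end StabilizerCode

theorem supportsOp_vecMulVec {C : StabilizerCode n} {ψ : Ket n} (hψ : ψ ∈ C.codeSpace) :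
    C.SupportsOp (Matrix.vecMulVec ψ (star ψ)) := by
  have h : C.projector * Matrix.vecMulVec ψ (star ψ) = Matrix.vecMulVec ψ (star ψ) := by
    rw [Matrix.mul_vecMulVec, C.mem_codeSpace_iff.1 hψ]
  refine C.supportsOp_iff.2 ⟨h, ?_⟩
  have := congrArg Matrix.conjTranspose h
  rwa [Matrix.conjTranspose_mul, Matrix.conjTranspose_vecMulVec, star_star,
    C.projector_isHermitian] at this

theorem trace_mul_sld_sq_of_pure {ψ : Ket n} (hψ : star ψ ⬝ᵥ ψ = 1) {Q : Op n}
    (hQ0 : star ψ ⬝ᵥ Q *ᵥ ψ = 0) {l : ℂ} (hQ2 : Q *ᵥ Q *ᵥ ψ = l ^ 2 • ψ) (c : ℂ) :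
    let ρ := Matrix.vecMulVec ψ (star ψ)
    (ρ * (((2 * c) • (Q * ρ - ρ * Q)) * ((2 * c) • (Q * ρ - ρ * Q)))).trace =
      -(4 * l ^ 2 * c ^ 2) := by
  intro ρ
  have h1 : ρ * ρ = ρ := by rw [Matrix.vecMulVec_mul_vecMulVec, hψ, one_smul]
  have h2 : ρ * Q * ρ = 0 := by rw [vecMulVec_mul_mul_vecMulVec, hQ0, zero_smul]
  have h3 : Q * (Q * ρ) = l ^ 2 • ρ := by
    rw [Matrix.mul_vecMulVec, Matrix.mul_vecMulVec, hQ2, Matrix.smul_vecMulVec]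
  have htr : ρ.trace = 1 := by rw [Matrix.trace_vecMulVec, dotProduct_comm, hψ]
  have key : ρ * ((Q * ρ - ρ * Q) * (Q * ρ - ρ * Q)) = -(l ^ 2) • ρ := by
    have h4 : ρ * (Q * ρ - ρ * Q) = -(ρ * Q) := by
      rw [mul_sub, ← mul_assoc, h2, ← mul_assoc, h1, zero_sub]
    rw [← mul_assoc, h4, neg_mul, mul_sub, mul_assoc, h3, ← mul_assoc (ρ * Q), h2, zero_mul,
      sub_zero, mul_smul_comm, h1, neg_smul]
  rw [smul_mul_smul_comm, mul_smul_comm, key, Matrix.trace_smul, Matrix.trace_smul, htr]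
  simp only [smul_eq_mul]
  ring

theorem isHermitian_smul_commutator {ρ Q : Op n} (hρ : ρ.IsHermitian) (hQ : Q.IsHermitian)
    (t : ℝ) : ((2 * (-Complex.I * t)) • (Q * ρ - ρ * Q)).IsHermitian := by
  rw [Matrix.IsHermitian, Matrix.conjTranspose_smul, Matrix.conjTranspose_sub,
    Matrix.conjTranspose_mul, Matrix.conjTranspose_mul, hρ.eq, hQ.eq]
  simp only [star_mul', Complex.star_def, map_neg, Complex.conj_I, Complex.conj_ofReal, map_ofNat]
  module

theorem exists_ofReal_eq_trace_mul {ρ L : Op n} (hρ : ρ.IsHermitian) (hL : L.IsHermitian) :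
    ∃ F : ℝ, (F : ℂ) = (ρ * (L * L)).trace := by
  refine ⟨_, Complex.conj_eq_iff_re.1 ?_⟩
  rw [← Complex.star_def, ← Matrix.trace_conjTranspose, Matrix.conjTranspose_mul,
    Matrix.conjTranspose_mul, hL.eq, hρ.eq, Matrix.trace_mul_comm]

end QuantumMetrology

end

open QuantumMetrology in
theorem lemma1 (n : ℕ) (C : StabilizerCode n) (hC : C.HasParameters 1 3) :
    -- single-qubit errors can be corrected with this code
    (∃ R : Op n → Op n, IsRecovery C R) ∧
    -- the output QFI is well defined and bounded, for every initial code state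
    (∀ (E : Environment n) (R : Op n → Op n), IsRecovery C R →
      ∀ ρ₀ : Op n, C.IsCodeState ρ₀ → ∀ (ω t : ℝ), 0 ≤ t →
        (∃ F : ℝ, IsOutputQFI E R t ρ₀ ω F) ∧
        ∀ F : ℝ, IsOutputQFI E R t ρ₀ ω F → F ≤ 4 * (numLogical C : ℝ) ^ 2 * t ^ 2) ∧
    -- the bound is attained by a pure code state when all `Z`-type stabilizers are positive
    (C.PositiveZType →
      ∃ ψ ∈ C.codeSpace, star ψ ⬝ᵥ ψ = 1 ∧
        ∀ (E : Environment n) (R : Op n → Op n), IsRecovery C R → ∀ (ω t : ℝ), 0 ≤ t →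
          IsOutputQFI E R t (Matrix.vecMulVec ψ (star ψ)) ω
            (4 * (numLogical C : ℝ) ^ 2 * t ^ 2)) := by
  obtain ⟨hdim, ⟨P, hP, hweight⟩, hmin⟩ := hC
  rw [pow_one] at hdim
  have hdist : ∀ P, C.IsLogical P → 2 < weight P := fun P hP => hmin ⟨P, hP, rfl⟩
  have htr : C.projector.trace = 2 := by rw [C.trace_projector, hdim, Nat.cast_ofNat]
  have htr0 : C.projector.trace ≠ 0 := by rw [htr]; exact two_ne_zero
  -- A qubit is needed to view the identity as a single-qubit error; a logical operator of weight 3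
  -- supplies one.
  obtain ⟨i⟩ : Nonempty (Fin n) := by
    classical
    have hpos : 0 < weight P := by omega
    exact ⟨(Finset.card_pos.1 hpos).choose⟩
  refine ⟨C.exists_isRecovery (by omega) hdist, fun E R hR ρ₀ hρ₀ ω t _ => ⟨?_, ?_⟩,
    fun hZ => ?_⟩
  · obtain ⟨hpsd, htr1, hsupp⟩ := hρ₀
    obtain ⟨d, hd⟩ := hsupp.exists_mul_self_eq hdim htr1
    have hL := isHermitian_smul_commutator hpsd.isHermitian C.logicalG_isHermitian t
    obtain ⟨F, hF⟩ := exists_ofReal_eq_trace_mul hpsd.isHermitian hL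
    exact ⟨F, _, fun w => hR.isOutputState hdist i htr0 E w t hsupp,
      isQFI_rotate C.phase ω t hL (sld_of_mul_self_eq hd C.commute_logicalG_projector) hF⟩
  · rintro F ⟨ρ, hρ, hqfi⟩
    obtain ⟨hpsd, htr1, hsupp⟩ := hρ₀
    -- Limits are unique, so the family in the hypothesis is the rotated one for every parameter
    -- value and has the same derivative.
    obtain rfl : ρ = fun w => rotate C.phase (w * t) ρ₀ := funext fun w =>
      tendsto_nhds_unique (hρ w) (hR.isOutputState hdist i htr0 E w t hsupp)
    obtain ⟨L, hL, hsld, hF⟩ := hqfi.exists_sld_of_rotate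
    have hpsd' := rotate_posSemidef C.phase (ω * t) hpsd
    have h1 := le_four_mul_trace_of_sld hpsd' hL C.logicalG_isHermitian hsld hF
    have h2 := trace_mul_diagonal_sq_le hpsd' (by rw [trace_rotate, htr1]) C.abs_phase_le
    have h3 : (F : ℂ) ≤ 4 * t ^ 2 * ((numLogical C : ℝ) : ℂ) ^ 2 :=
      h1.trans (mul_le_mul_of_nonneg_left h2
        (by exact_mod_cast (by positivity : (0 : ℝ) ≤ 4 * t ^ 2)))
    have h4 : F ≤ 4 * t ^ 2 * (numLogical C : ℝ) ^ 2 := by exact_mod_cast h3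
    linarith
  · obtain ⟨ψ, hψ, hunit, hQ0, hQ2⟩ := C.exists_optimal_state htr hZ
    refine ⟨ψ, hψ, hunit, fun E R hR ω t _ => ?_⟩
    have hρh : (Matrix.vecMulVec ψ (star ψ)).IsHermitian := by
      rw [Matrix.IsHermitian, Matrix.conjTranspose_vecMulVec, star_star]
    have hsq : Matrix.vecMulVec ψ (star ψ) * Matrix.vecMulVec ψ (star ψ) =
        Matrix.vecMulVec ψ (star ψ) - (0 : ℂ) • C.projector := by
      rw [Matrix.vecMulVec_mul_vecMulVec, hunit, one_smul, zero_smul, sub_zero]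
    refine ⟨_, fun w => hR.isOutputState hdist i htr0 E w t (supportsOp_vecMulVec hψ),
      isQFI_rotate C.phase ω t (isHermitian_smul_commutator hρh C.logicalG_isHermitian t)
        (sld_of_mul_self_eq hsq C.commute_logicalG_projector) ?_⟩
    rw [trace_mul_sld_sq_of_pure hunit hQ0 hQ2]
    push_cast
    rw [mul_pow, neg_sq, Complex.I_sq]
    ring
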